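/- Let $K=\mathbb F_2(a)$, where $a$ is a formal variable. Let $\mathbf t=(t_n)_{n\ge0}$ be the $(a,1)$-Thue--Morse sequence, i.e. the fixed point $s^\infty(a)$ of the substitution $s:a\mapsto a1,\ 1\mapsto 1a$, and let $\bar{\mathbf t}=(\bar t_n)_{n\ge 0}$ be the $(1,a)$-Thue--Morse sequence, obtained from $\mathbf t$ by exchanging $a$ and $1$. For $n\ge0$ define the $2\times2$ matrices over $K[x]$ $$M_n=\begin{pmatrix}1&t_{2^n-1}x\\1&0\end{pmatrix}\cdots\begin{pmatrix}1&t_1x\\1&0\end{pmatrix}\begin{pmatrix}1&t_0x\\1&0\end{pmatrix},\qquad W_n=\begin{pmatrix}1&\bar t_{2^n-1}x\\1&0\end{pmatrix}\cdots\begin{pmatrix}1&\bar t_1x\\1&0\end{pmatrix}\begin{pmatrix}1&\bar t_0x\\1&0\end{pmatrix}.$$ Let $M^e,M^o,W^e,W^o$ be the $2\times 2$ matrices over $K[[x]]$ (rows and columns indexed by $0,1$) such that, for $T\in\{M^e,M^o,W^e,W^o\}$ and $i,j\in\{0,1\}$, the entry $T_{i,j}$ is the unique root in $K[[x]]$ of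 the polynomial $$\phi(T,i,j)=c_0(x)+c_3(x)y^3+c_6(x)y^6+c_9(x)y^9+c_{12}(x)y^{12}$$ whose coefficients of $x^0$ and $x^1$ are the two initial terms listed together with $\phi(T,i,j)$ at the end of this statement. For a matrix $T$ over $K[[x]]$ let $T[:\!u]$ denote its entrywise truncation to the terms of degree less than $u$ in $x$, and let $I_2$ be the identity matrix. Suppose that the following truncation identities hold: for every $k\ge2$ and $u=2^{2k-1}$, $$M_{2k}=M^e[:\!u]+a^{u/2}x^uI_2,\qquad W_{2k}=W^e[:\!u]+a^{u/2}x^uI_2,$$ and for every $k\ge2$ and $u=2^{2k}$, $$M_{2k+1}=M^o[:\!u]+a^{u/2}x^uI_2,\qquad W_{2k+1}=W^o[:\!u]+a^{u/2}x^uI_2.$$ Then the Stieltjes continued fraction $$\mathrm{Stiel}(x;\mathbf t)=\cfrac{t_0}{1+\cfrac{t_1x}{1+\cfrac{t_2x}{\ddots}}}\in K[[x]]$$ (the $x$-adic limit of the finite continued fractions obtained by stopping at $1+t_nx$) is algebraic over $K(x)=\mathbb F_2(a)(x)$, and its minimal polynomial over $K(x)$ is, up to normalization of the leading coefficient, $p_0(x)+p_1(x)y+p_2(x)y^2+p_4(x)y^4$,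 where \begin{align*} p_0(x)&=\frac{a^2+1}{a^4}x^2+\frac1{a^5+a^4},& p_1(x)&=\frac{a+1}{a^5}x+\frac1{a^5},\\ p_2(x)&=\frac1{a^5}x+\frac1{a^6+a^5},& p_4(x)&=\frac1{a^6+a^5}x^2. \end{align*} The polynomials $\phi(T,i,j)$ are given by the following coefficients $c_j=c_j(x)$ (coefficients that are not listed are $0$). For $\phi(M^e,0,0)$: initial terms $[1,a]$ and \begin{align*} c_{0}&=(a^{12}+a^{11}+a^{4}+a^{3})x^{12}+(a^{10}+a^{9}+a^{7}+a^{5}+a^{3}+a^{2})x^{10}+(a^{8}+a^{7}+a^{2}+a)x^{8}+(a^{6}+a^{5}+a^{3}+a+1)x^{6},\\ c_{3}&=(a^{9}+a)x^{9}+(a^{8}+1)x^{8}+(a^{6}+a^{5}+a^{2}+a)x^{7}+(a^{5}+a)x^{5}+(a^{4}+1)x^{4}+(a^{2}+a)x^{3},\\ c_{6}&=(a^{9}+a)x^{9}+(a^{7}+a^{6}+a^{5}+a^{4}+a^{3}+a^{2}+a+1)x^{8}+(a^{6}+a^{5}+a^{2}+a)x^{7}+(a^{6}+a^{5}+a^{4}+a^{2}+a+1)x^{6}+(a^{4}+1)x^{5}+(a^{4}+a^{3}+a^{2}+a)x^{4}+(a^{2}+a)x^{3}+(a^{2}+a+1)x^{2}+(a+1)x+1,\\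 c_{9}&=(a^{8}+1)x^{8}+(a^{7}+a^{6}+a^{5}+a^{4}+a^{3}+a^{2}+a+1)x^{7}+(a^{6}+a^{4}+a^{2}+1)x^{6}+(a^{5}+a^{4}+a+1)x^{5}+(a^{4}+1)x^{4}+(a^{3}+a^{2}+a+1)x^{3}+(a^{2}+1)x^{2}+(a+1)x,\\ c_{12}&=(a^{8}+1)x^{8}+1. \end{align*} For $\phi(M^e,0,1)$: initial terms $[0,a]$ and \begin{align*} c_{0}&=(a^{24}+a^{22}+a^{8}+a^{6})x^{24}+(a^{22}+a^{21}+a^{6}+a^{5})x^{22}+(a^{20}+a^{19}+a^{18}+a^{17}+a^{15}+a^{14}+a^{13}+a^{11}+a^{10}+a^{9}+a^{7}+a^{6}+a^{5}+a^{4})x^{20}+(a^{18}+a^{17}+a^{16}+a^{15}+a^{14}+a^{13}+a^{12}+a^{11}+a^{10}+a^{9}+a^{8}+a^{7}+a^{6}+a^{5}+a^{4}+a^{3})x^{18}+(a^{15}+a^{12}+a^{11}+a^{10}+a^{8}+a^{7}+a^{6}+a^{3})x^{16}+(a^{12}+a^{11}+a^{10}+a^{9}+a^{6}+a^{5}+a^{4}+a^{3})x^{14}+(a^{9}+a^{8}+a^{6}+a^{4}+a^{3})x^{12},\\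 c_{3}&=(a^{14}+a^{12}+a^{10}+a^{8}+a^{6}+a^{4}+a^{2}+1)x^{14}+(a^{13}+a^{12}+a^{9}+a^{8}+a^{5}+a^{4}+a+1)x^{13}+(a^{10}+a^{8}+a^{2}+1)x^{10}+(a^{9}+a^{8}+a+1)x^{9},\\ c_{6}&=(a^{12}+a^{8}+a^{4}+1)x^{12}+(a^{10}+a^{8}+a^{2}+1)x^{10}+(a^{8}+1)x^{8}+(a^{6}+a^{4}+a^{2}+1)x^{6},\\ c_{9}&=(a^{10}+a^{8}+a^{2}+1)x^{10}+(a^{9}+a^{8}+a+1)x^{9}+(a^{8}+1)x^{8}+(a^{7}+a^{6}+a^{5}+a^{4}+a^{3}+a^{2}+a+1)x^{7}+(a^{6}+a^{4}+a^{2}+1)x^{6}+(a^{5}+a^{4}+a+1)x^{5}+(a^{4}+1)x^{4}+(a^{3}+a^{2}+a+1)x^{3},\\ c_{12}&=(a^{8}+1)x^{8}+1. \end{align*} For $\phi(M^e,1,0)$: initial terms $[1,0]$ and \begin{align*} c_{0}&=1,\\ c_{3}&=(a^{2}+1)x^{2}+1. \end{align*} For $\phi(M^e,1,1)$: initial terms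 $[0,a]$ and \begin{align*} c_{0}&=(a^{12}+a^{11}+a^{4}+a^{3})x^{12}+(a^{9}+a^{7}+a^{5}+a^{3})x^{10}+(a^{6}+a^{5}+a^{4}+a^{3})x^{8}+a^{3}x^{6},\\ c_{3}&=(a^{9}+a)x^{9}+(a^{8}+1)x^{8}+(a^{7}+a^{4}+a^{3}+1)x^{7}+(a^{5}+a)x^{5}+(a^{4}+1)x^{4}+(a^{3}+1)x^{3},\\ c_{6}&=(a^{9}+a)x^{9}+(a^{7}+a^{6}+a^{5}+a^{4}+a^{3}+a^{2}+a+1)x^{8}+(a^{7}+a^{4}+a^{3}+1)x^{7}+(a^{5}+a)x^{6}+(a^{4}+1)x^{5}+(a^{4}+a^{3}+a^{2}+a)x^{4}+(a^{3}+1)x^{3}+ax^{2}+(a+1)x+1,\\ c_{9}&=(a^{8}+1)x^{8}+(a^{7}+a^{6}+a^{5}+a^{4}+a^{3}+a^{2}+a+1)x^{7}+(a^{6}+a^{4}+a^{2}+1)x^{6}+(a^{5}+a^{4}+a+1)x^{5}+(a^{4}+1)x^{4}+(a^{3}+a^{2}+a+1)x^{3}+(a^{2}+1)x^{2}+(a+1)x,\\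 c_{12}&=(a^{8}+1)x^{8}+1. \end{align*} For $\phi(M^o,0,0)$: initial terms $[1,a]$ and \begin{align*} c_{0}&=(a^{9}+a^{8}+a+1)x^{12}+(a^{8}+a^{7}+a^{5}+a^{3}+a+1)x^{10}+(a^{7}+a^{6}+a+1)x^{8}+(a^{6}+a^{5}+a^{3}+a+1)x^{6},\\ c_{3}&=(a^{7}+a^{6}+a^{5}+a^{4}+a^{3}+a^{2}+a+1)x^{8}+(a^{7}+a^{5}+a^{3}+a)x^{7}+(a^{6}+a^{2})x^{6}+(a^{5}+a^{4}+a^{3}+a^{2})x^{5}+(a^{4}+a^{3}+a+1)x^{4}+(a^{2}+a)x^{3},\\ c_{6}&=(a^{6}+a^{4}+a^{2}+1)x^{7}+(a^{6}+a^{5}+a^{2}+a)x^{6}+(a^{3}+a^{2}+a+1)x^{5}+(a^{2}+1)x^{4}+(a^{3}+1)x^{3}+ax^{2}+(a+1)x+1,\\ c_{9}&=(a^{5}+a^{4}+a+1)x^{5}+(a+1)x,\\ c_{12}&=(a^{4}+1)x^{4}+1. \end{align*} For $\phi(M^o,0,1)$: initial terms $[0,a]$ and \begin{align*} c_{0}&=(a^{21}+a^{19}+a^{5}+a^{3})x^{24}+(a^{20}+a^{4})x^{22}+(a^{19}+a^{16}+a^{12}+a^{8}+a^{4}+a^{3})x^{20}+(a^{18}+a^{14}+a^{10}+a^{6})x^{18}+(a^{15}+a^{14}+a^{9}+a^{6}+a^{5}+a^{3})x^{16}+(a^{12}+a^{10}+a^{6}+a^{4})x^{14}+(a^{9}+a^{8}+a^{6}+a^{4}+a^{3})x^{12},\\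 c_{3}&=(a^{16}+1)x^{16}+(a^{15}+a^{14}+a^{13}+a^{12}+a^{11}+a^{10}+a^{9}+a^{8}+a^{7}+a^{6}+a^{5}+a^{4}+a^{3}+a^{2}+a+1)x^{15}+(a^{14}+a^{12}+a^{10}+a^{8}+a^{6}+a^{4}+a^{2}+1)x^{14}+(a^{13}+a^{12}+a^{9}+a^{8}+a^{5}+a^{4}+a+1)x^{13}+(a^{12}+a^{8}+a^{4}+1)x^{12}+(a^{11}+a^{10}+a^{9}+a^{8}+a^{3}+a^{2}+a+1)x^{11}+(a^{10}+a^{8}+a^{2}+1)x^{10}+(a^{9}+a^{8}+a+1)x^{9},\\ c_{6}&=(a^{12}+a^{8}+a^{4}+1)x^{12}+(a^{10}+a^{8}+a^{2}+1)x^{10}+(a^{8}+1)x^{8}+(a^{6}+a^{4}+a^{2}+1)x^{6},\\ c_{9}&=(a^{8}+1)x^{8}+(a^{7}+a^{6}+a^{5}+a^{4}+a^{3}+a^{2}+a+1)x^{7}+(a^{4}+1)x^{4}+(a^{3}+a^{2}+a+1)x^{3},\\ c_{12}&=(a^{4}+1)x^{4}+1. \end{align*} For $\phi(M^o,1,0)$: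 initial terms $[1,a+1]$ and \begin{align*} c_{0}&=1,\\ c_{3}&=(a+1)x+1. \end{align*} For $\phi(M^o,1,1)$: initial terms $[0,a]$ and \begin{align*} c_{0}&=(a^{12}+a^{11}+a^{4}+a^{3})x^{12}+(a^{9}+a^{7}+a^{5}+a^{3})x^{10}+(a^{6}+a^{5}+a^{4}+a^{3})x^{8}+a^{3}x^{6},\\ c_{3}&=(a^{8}+a^{7}+a^{6}+a^{5}+a^{4}+a^{3}+a^{2}+a)x^{8}+(a^{6}+a^{4}+a^{2}+1)x^{7}+(a^{6}+a^{2})x^{6}+(a^{5}+a^{4}+a^{3}+a^{2})x^{5}+(a^{3}+a)x^{4}+(a^{3}+1)x^{3},\\ c_{6}&=(a^{7}+a^{5}+a^{3}+a)x^{7}+(a^{5}+a^{4}+a+1)x^{6}+(a^{3}+a^{2}+a+1)x^{5}+(a^{2}+1)x^{4}+(a^{2}+a)x^{3}+(a^{2}+a+1)x^{2}+(a+1)x+1,\\ c_{9}&=(a^{5}+a^{4}+a+1)x^{5}+(a+1)x,\\ c_{12}&=(a^{4}+1)x^{4}+1. \end{align*} For $\phi(W^e,0,0)$: initial terms $[1,1]$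 and \begin{align*} c_{0}&=(a^{9}+a^{8}+a+1)x^{12}+(a^{8}+a^{7}+a^{5}+a^{3}+a+1)x^{10}+(a^{7}+a^{6}+a+1)x^{8}+(a^{6}+a^{5}+a^{3}+a+1)x^{6},\\ c_{3}&=(a^{8}+1)x^{9}+(a^{8}+1)x^{8}+(a^{6}+a^{5}+a^{2}+a)x^{7}+(a^{4}+1)x^{5}+(a^{4}+1)x^{4}+(a^{2}+a)x^{3},\\ c_{6}&=(a^{8}+1)x^{9}+(a^{8}+a^{7}+a^{6}+a^{5}+a^{4}+a^{3}+a^{2}+a)x^{8}+(a^{6}+a^{5}+a^{2}+a)x^{7}+(a^{6}+a^{5}+a^{4}+a^{2}+a+1)x^{6}+(a^{5}+a)x^{5}+(a^{3}+a^{2}+a+1)x^{4}+(a^{2}+a)x^{3}+(a^{2}+a+1)x^{2}+(a+1)x+1,\\ c_{9}&=(a^{8}+1)x^{8}+(a^{7}+a^{6}+a^{5}+a^{4}+a^{3}+a^{2}+a+1)x^{7}+(a^{6}+a^{4}+a^{2}+1)x^{6}+(a^{5}+a^{4}+a+1)x^{5}+(a^{4}+1)x^{4}+(a^{3}+a^{2}+a+1)x^{3}+(a^{2}+1)x^{2}+(a+1)x,\\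 c_{12}&=(a^{8}+1)x^{8}+1. \end{align*} For $\phi(W^e,0,1)$: initial terms $[0,1]$ and \begin{align*} c_{0}&=(a^{18}+a^{16}+a^{2}+1)x^{24}+(a^{17}+a^{16}+a+1)x^{22}+(a^{16}+a^{15}+a^{14}+a^{13}+a^{11}+a^{10}+a^{9}+a^{7}+a^{6}+a^{5}+a^{3}+a^{2}+a+1)x^{20}+(a^{15}+a^{14}+a^{13}+a^{12}+a^{11}+a^{10}+a^{9}+a^{8}+a^{7}+a^{6}+a^{5}+a^{4}+a^{3}+a^{2}+a+1)x^{18}+(a^{13}+a^{10}+a^{9}+a^{8}+a^{6}+a^{5}+a^{4}+a)x^{16}+(a^{11}+a^{10}+a^{9}+a^{8}+a^{5}+a^{4}+a^{3}+a^{2})x^{14}+(a^{9}+a^{8}+a^{6}+a^{4}+a^{3})x^{12},\\ c_{3}&=(a^{14}+a^{12}+a^{10}+a^{8}+a^{6}+a^{4}+a^{2}+1)x^{14}+(a^{13}+a^{12}+a^{9}+a^{8}+a^{5}+a^{4}+a+1)x^{13}+(a^{10}+a^{8}+a^{2}+1)x^{10}+(a^{9}+a^{8}+a+1)x^{9},\\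 c_{6}&=(a^{12}+a^{8}+a^{4}+1)x^{12}+(a^{10}+a^{8}+a^{2}+1)x^{10}+(a^{8}+1)x^{8}+(a^{6}+a^{4}+a^{2}+1)x^{6},\\ c_{9}&=(a^{10}+a^{8}+a^{2}+1)x^{10}+(a^{9}+a^{8}+a+1)x^{9}+(a^{8}+1)x^{8}+(a^{7}+a^{6}+a^{5}+a^{4}+a^{3}+a^{2}+a+1)x^{7}+(a^{6}+a^{4}+a^{2}+1)x^{6}+(a^{5}+a^{4}+a+1)x^{5}+(a^{4}+1)x^{4}+(a^{3}+a^{2}+a+1)x^{3},\\ c_{12}&=(a^{8}+1)x^{8}+1. \end{align*} For $\phi(W^e,1,0)$: initial terms $[1,0]$ and \begin{align*} c_{0}&=1,\\ c_{3}&=(a^{2}+1)x^{2}+1. \end{align*} For $\phi(W^e,1,1)$: initial terms $[0,1]$ and \begin{align*} c_{0}&=(a^{9}+a^{8}+a+1)x^{12}+(a^{7}+a^{5}+a^{3}+a)x^{10}+(a^{5}+a^{4}+a^{3}+a^{2})x^{8}+a^{3}x^{6},\\ c_{3}&=(a^{8}+1)x^{9}+(a^{8}+1)x^{8}+(a^{7}+a^{4}+a^{3}+1)x^{7}+(a^{4}+1)x^{5}+(a^{4}+1)x^{4}+(a^{3}+1)x^{3},\\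 c_{6}&=(a^{8}+1)x^{9}+(a^{8}+a^{7}+a^{6}+a^{5}+a^{4}+a^{3}+a^{2}+a)x^{8}+(a^{7}+a^{4}+a^{3}+1)x^{7}+(a^{5}+a)x^{6}+(a^{5}+a)x^{5}+(a^{3}+a^{2}+a+1)x^{4}+(a^{3}+1)x^{3}+ax^{2}+(a+1)x+1,\\ c_{9}&=(a^{8}+1)x^{8}+(a^{7}+a^{6}+a^{5}+a^{4}+a^{3}+a^{2}+a+1)x^{7}+(a^{6}+a^{4}+a^{2}+1)x^{6}+(a^{5}+a^{4}+a+1)x^{5}+(a^{4}+1)x^{4}+(a^{3}+a^{2}+a+1)x^{3}+(a^{2}+1)x^{2}+(a+1)x,\\ c_{12}&=(a^{8}+1)x^{8}+1. \end{align*} For $\phi(W^o,0,0)$: initial terms $[1,1]$ and \begin{align*} c_{0}&=(a^{12}+a^{11}+a^{4}+a^{3})x^{12}+(a^{10}+a^{9}+a^{7}+a^{5}+a^{3}+a^{2})x^{10}+(a^{8}+a^{7}+a^{2}+a)x^{8}+(a^{6}+a^{5}+a^{3}+a+1)x^{6},\\ c_{3}&=(a^{8}+a^{7}+a^{6}+a^{5}+a^{4}+a^{3}+a^{2}+a)x^{8}+(a^{6}+a^{4}+a^{2}+1)x^{7}+(a^{4}+1)x^{6}+(a^{3}+a^{2}+a+1)x^{5}+(a^{4}+a^{3}+a+1)x^{4}+(a^{2}+a)x^{3},\\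 c_{6}&=(a^{7}+a^{5}+a^{3}+a)x^{7}+(a^{5}+a^{4}+a+1)x^{6}+(a^{5}+a^{4}+a^{3}+a^{2})x^{5}+(a^{4}+a^{2})x^{4}+(a^{3}+1)x^{3}+ax^{2}+(a+1)x+1,\\ c_{9}&=(a^{5}+a^{4}+a+1)x^{5}+(a+1)x,\\ c_{12}&=(a^{4}+1)x^{4}+1. \end{align*} For $\phi(W^o,0,1)$: initial terms $[0,1]$ and \begin{align*} c_{0}&=(a^{21}+a^{19}+a^{5}+a^{3})x^{24}+(a^{18}+a^{2})x^{22}+(a^{17}+a^{16}+a^{12}+a^{8}+a^{4}+a)x^{20}+(a^{12}+a^{8}+a^{4}+1)x^{18}+(a^{13}+a^{11}+a^{10}+a^{7}+a^{2}+a)x^{16}+(a^{10}+a^{8}+a^{4}+a^{2})x^{14}+(a^{9}+a^{8}+a^{6}+a^{4}+a^{3})x^{12},\\ c_{3}&=(a^{16}+1)x^{16}+(a^{15}+a^{14}+a^{13}+a^{12}+a^{11}+a^{10}+a^{9}+a^{8}+a^{7}+a^{6}+a^{5}+a^{4}+a^{3}+a^{2}+a+1)x^{15}+(a^{14}+a^{12}+a^{10}+a^{8}+a^{6}+a^{4}+a^{2}+1)x^{14}+(a^{13}+a^{12}+a^{9}+a^{8}+a^{5}+a^{4}+a+1)x^{13}+(a^{12}+a^{8}+a^{4}+1)x^{12}+(a^{11}+a^{10}+a^{9}+a^{8}+a^{3}+a^{2}+a+1)x^{11}+(a^{10}+a^{8}+a^{2}+1)x^{10}+(a^{9}+a^{8}+a+1)x^{9},\\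 c_{6}&=(a^{12}+a^{8}+a^{4}+1)x^{12}+(a^{10}+a^{8}+a^{2}+1)x^{10}+(a^{8}+1)x^{8}+(a^{6}+a^{4}+a^{2}+1)x^{6},\\ c_{9}&=(a^{8}+1)x^{8}+(a^{7}+a^{6}+a^{5}+a^{4}+a^{3}+a^{2}+a+1)x^{7}+(a^{4}+1)x^{4}+(a^{3}+a^{2}+a+1)x^{3},\\ c_{12}&=(a^{4}+1)x^{4}+1. \end{align*} For $\phi(W^o,1,0)$: initial terms $[1,a+1]$ and \begin{align*} c_{0}&=1,\\ c_{3}&=(a+1)x+1. \end{align*} For $\phi(W^o,1,1)$: initial terms $[0,1]$ and \begin{align*} c_{0}&=(a^{9}+a^{8}+a+1)x^{12}+(a^{7}+a^{5}+a^{3}+a)x^{10}+(a^{5}+a^{4}+a^{3}+a^{2})x^{8}+a^{3}x^{6},\\ c_{3}&=(a^{7}+a^{6}+a^{5}+a^{4}+a^{3}+a^{2}+a+1)x^{8}+(a^{7}+a^{5}+a^{3}+a)x^{7}+(a^{4}+1)x^{6}+(a^{3}+a^{2}+a+1)x^{5}+(a^{3}+a)x^{4}+(a^{3}+1)x^{3},\\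 c_{6}&=(a^{6}+a^{4}+a^{2}+1)x^{7}+(a^{6}+a^{5}+a^{2}+a)x^{6}+(a^{5}+a^{4}+a^{3}+a^{2})x^{5}+(a^{4}+a^{2})x^{4}+(a^{2}+a)x^{3}+(a^{2}+a+1)x^{2}+(a+1)x+1,\\ c_{9}&=(a^{5}+a^{4}+a+1)x^{5}+(a+1)x,\\ c_{12}&=(a^{4}+1)x^{4}+1. \end{align*} -/

import Mathlib

open scoped PowerSeries LaurentSeries RatFunc

/-! ## The Thue–Morse sequence -/

/-- The substitution `a ↦ ab`, `b ↦ ba` on the alphabet `{a, b}`; `false` is the letter `a` and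
`true` is the letter `b`. -/
def tmSubst (c : Bool) : List Bool := [c, !c]

/-- The word `sⁿ(a)`. -/
def tmWord : ℕ → List Bool
  | 0 => [false]
  | n + 1 => (tmWord n).flatMap tmSubst

/-- The `n`-th letter of `s^∞(a) = lim sᵐ(a)`.  Each `sᵐ(a)` is a prefix of `sᵐ⁺¹(a)`, and
`sⁿ(a)` has length `2ⁿ > n`, so the letter is read off in `sⁿ(a)`. -/
def tmLetter (n : ℕ) : Bool := (tmWord n).getD n false

/-- The `(a, b)`-Thue–Morse sequence. -/
def thueMorse {K : Type*} (a b : K) (n : ℕ) : K := if tmLetter n then b else a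

theorem length_tmWord (n : ℕ) : (tmWord n).length = 2 ^ n := by
  induction n with
  | zero => rfl
  | succ n ih =>
    rw [tmWord, List.length_flatMap]
    simp [tmSubst, ih, pow_succ]

theorem flatMap_tmSubst_getD (l : List Bool) : ∀ n < l.length,
    (l.flatMap tmSubst).getD (2 * n) false = l.getD n false ∧
      (l.flatMap tmSubst).getD (2 * n + 1) false = !(l.getD n false) := by
  induction l with
  | nil => intro n hn; simp at hn
  | cons c l ih =>
    intro n hn
    cases n with
    | zero => simp [tmSubst]
    | succ n =>
      have h := ih n (by simpa using hn)
      have e : 2 * (n + 1) = 2 * n + 1 + 1 := by ring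
      rw [e]
      simpa [tmSubst] using h

theorem tmWord_prefix (n : ℕ) : tmWord n <+: tmWord (n + 1) := by
  induction n with
  | zero => exact ⟨[true], rfl⟩
  | succ n ih =>
    obtain ⟨w, hw⟩ := ih
    refine ⟨w.flatMap tmSubst, ?_⟩
    rw [tmWord, ← List.flatMap_append, hw, ← tmWord]

theorem tmWord_getD {m n k : ℕ} (hk : k < 2 ^ m) (hmn : m ≤ n) :
    (tmWord n).getD k false = (tmWord m).getD k false := by
  induction n, hmn using Nat.le_induction with
  | base => rfl
  | succ n hn ih =>
    rw [← ih]
    obtain ⟨w, hw⟩ := tmWord_prefix n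
    rw [← hw, List.getD_append]
    rw [length_tmWord]
    exact hk.trans_le (Nat.pow_le_pow_right (by norm_num) hn)

theorem tmWord_getD_eq_tmLetter {n k : ℕ} (hk : k < 2 ^ n) :
    (tmWord n).getD k false = tmLetter k := by
  rcases le_total k n with h | h
  · exact tmWord_getD Nat.lt_two_pow_self h
  · exact (tmWord_getD hk h).symm

/-- The sequence is fixed by the substitution: the letters at positions `2n` and `2n + 1` are
`tmSubst` of the letter at position `n`. -/
theorem tmLetter_two_mul (n : ℕ) :
    tmLetter (2 * n) = tmLetter n ∧ tmLetter (2 * n + 1) = !tmLetter n := by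
  have hn : n < 2 ^ n := Nat.lt_two_pow_self
  have h := flatMap_tmSubst_getD (tmWord n) n (by rw [length_tmWord]; exact hn)
  have h₀ : 2 * n < 2 ^ (n + 1) := by rw [pow_succ]; omega
  have h₁ : 2 * n + 1 < 2 ^ (n + 1) := by rw [pow_succ]; omega
  rw [← tmWord_getD_eq_tmLetter h₀, ← tmWord_getD_eq_tmLetter h₁, ← tmWord_getD_eq_tmLetter hn]
  exact h

/-! ## Stieltjes continued fractions -/

section Stieltjes

variable {K : Type*} [Field K]

/-- The finite Stieltjes continued fraction
`u₀ / (1 + u₁x / (1 + u₂x / (⋯ / (1 + uₙx))))` in `K⟦X⟧`. -/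
noncomputable def stieltjesFin (u : ℕ → K) : ℕ → K⟦X⟧
  | 0 => PowerSeries.C (u 0)
  | n + 1 => PowerSeries.C (u 0) *
      (1 + PowerSeries.X * stieltjesFin (fun j => u (j + 1)) n)⁻¹

/-- The Stieltjes continued fraction of `u`: the `X`-adic limit of the finite ones.  By
`coeff_stieltjesFin` the coefficient of `xᵈ` is the same in all finite continued fractions with
index at least `d`. -/
noncomputable def stieltjes (u : ℕ → K) : K⟦X⟧ :=
  PowerSeries.mk fun d => PowerSeries.coeff d (stieltjesFin u d)

theorem X_pow_dvd_stieltjesFin_sub (n : ℕ) : ∀ u : ℕ → K,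
    (PowerSeries.X : K⟦X⟧) ^ (n + 1) ∣ stieltjesFin u (n + 1) - stieltjesFin u n := by
  induction n with
  | zero =>
    intro u
    rw [zero_add, pow_one, PowerSeries.X_dvd_iff]
    simp [stieltjesFin]
  | succ n ih =>
    intro u
    obtain ⟨q, hq⟩ := ih (fun j => u (j + 1))
    rw [stieltjesFin, stieltjesFin.eq_2 u n]
    set f := stieltjesFin (fun j => u (j + 1)) (n + 1)
    set g := stieltjesFin (fun j => u (j + 1)) n
    have hf : (1 + PowerSeries.X * f) * (1 + PowerSeries.X * f)⁻¹ = 1 :=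
      PowerSeries.mul_inv_cancel _ (by simp)
    have hg : (1 + PowerSeries.X * g) * (1 + PowerSeries.X * g)⁻¹ = 1 :=
      PowerSeries.mul_inv_cancel _ (by simp)
    generalize (1 + PowerSeries.X * f)⁻¹ = F at *
    generalize (1 + PowerSeries.X * g)⁻¹ = G at *
    refine ⟨-(PowerSeries.C (u 0) * F * G * q), ?_⟩
    have e : F - G = -(PowerSeries.X * (f - g) * F * G) := by
      linear_combination G * hf - F * hg
    rw [hq] at e
    linear_combination PowerSeries.C (u 0) * e

theorem coeff_stieltjesFin (u : ℕ → K) {d n : ℕ} (h : d ≤ n) :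
    PowerSeries.coeff d (stieltjesFin u n) = PowerSeries.coeff d (stieltjes u) := by
  induction n, h using Nat.le_induction with
  | base => simp [stieltjes]
  | succ n hn ih =>
    rw [← ih, ← sub_eq_zero, ← map_sub]
    exact PowerSeries.X_pow_dvd_iff.1 (X_pow_dvd_stieltjesFin_sub n u) d (by omega)

/-- The product `A(t_{n-1}) ⋯ A(t_1) A(t_0)` with `A(c) = (1, c x; 1, 0)`. -/
noncomputable def stieltjesProd (t : ℕ → K) : ℕ → Matrix (Fin 2) (Fin 2) K⟦X⟧
  | 0 => 1
  | n + 1 => !![1, PowerSeries.C (t n) * PowerSeries.X; 1, 0] * stieltjesProd t n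

/-- The truncation `T[:u]` of a matrix of power series: in each entry, the sum of the terms of
degree less than `u`. -/
noncomputable def truncMatrix (u : ℕ) (T : Matrix (Fin 2) (Fin 2) K⟦X⟧) :
    Matrix (Fin 2) (Fin 2) K⟦X⟧ :=
  T.map fun f => ((PowerSeries.trunc u f : Polynomial K) : K⟦X⟧)

open Classical in
/-- The unique power series `y` with `φ y = 0` whose two initial coefficients are `c₀` and `c₁`
(and `0`, if there were no such series or several). -/
noncomputable def uniqueSolution (φ : K⟦X⟧ → K⟦X⟧) (c₀ c₁ : K) : K⟦X⟧ :=
  if h : ∃! y : K⟦X⟧, φ y = 0 ∧ PowerSeries.coeff 0 y = c₀ ∧ PowerSeries.coeff 1 y = c₁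
  then h.choose else 0

end Stieltjes

/-! ## The sixteen polynomials

`phiTij a x y` is the value at `y` of the polynomial
`p₀(x) + p₃(x) y³ + p₆(x) y⁶ + p₉(x) y⁹ + p₁₂(x) y¹²` that defines the `(i, j)` entry of the
matrix `T`, for `T` among `Mᵉ, Mᵒ, Wᵉ, Wᵒ`. -/

section Phi

variable {R : Type*} [CommRing R]

def phiMe00 (a x y : R) : R :=
    ((a ^ 12 + a ^ 11 + a ^ 4 + a ^ 3) * x ^ 12 + (a ^ 10 + a ^ 9 + a ^ 7 + a ^ 5 + a ^ 3 + a
      ^ 2) * x ^ 10 + (a ^ 8 + a ^ 7 + a ^ 2 + a) * x ^ 8 + (a ^ 6 + a ^ 5 + a ^ 3 + a + 1) *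
      x ^ 6) +
    ((a ^ 9 + a) * x ^ 9 + (a ^ 8 + 1) * x ^ 8 + (a ^ 6 + a ^ 5 + a ^ 2 + a) * x ^ 7 + (a ^ 5
      + a) * x ^ 5 + (a ^ 4 + 1) * x ^ 4 + (a ^ 2 + a) * x ^ 3) * y ^ 3 +
    ((a ^ 9 + a) * x ^ 9 + (a ^ 7 + a ^ 6 + a ^ 5 + a ^ 4 + a ^ 3 + a ^ 2 + a + 1) * x ^ 8 +
      (a ^ 6 + a ^ 5 + a ^ 2 + a) * x ^ 7 + (a ^ 6 + a ^ 5 + a ^ 4 + a ^ 2 + a + 1) * x ^ 6 +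
      (a ^ 4 + 1) * x ^ 5 + (a ^ 4 + a ^ 3 + a ^ 2 + a) * x ^ 4 + (a ^ 2 + a) * x ^ 3 + (a ^ 2
      + a + 1) * x ^ 2 + (a + 1) * x + 1) * y ^ 6 +
    ((a ^ 8 + 1) * x ^ 8 + (a ^ 7 + a ^ 6 + a ^ 5 + a ^ 4 + a ^ 3 + a ^ 2 + a + 1) * x ^ 7 +
      (a ^ 6 + a ^ 4 + a ^ 2 + 1) * x ^ 6 + (a ^ 5 + a ^ 4 + a + 1) * x ^ 5 + (a ^ 4 + 1) * x
      ^ 4 + (a ^ 3 + a ^ 2 + a + 1) * x ^ 3 + (a ^ 2 + 1) * x ^ 2 + (a + 1) * x) * y ^ 9 +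
    ((a ^ 8 + 1) * x ^ 8 + 1) * y ^ 12

def phiMe01 (a x y : R) : R :=
    ((a ^ 24 + a ^ 22 + a ^ 8 + a ^ 6) * x ^ 24 + (a ^ 22 + a ^ 21 + a ^ 6 + a ^ 5) * x ^ 22 +
      (a ^ 20 + a ^ 19 + a ^ 18 + a ^ 17 + a ^ 15 + a ^ 14 + a ^ 13 + a ^ 11 + a ^ 10 + a ^ 9
      + a ^ 7 + a ^ 6 + a ^ 5 + a ^ 4) * x ^ 20 + (a ^ 18 + a ^ 17 + a ^ 16 + a ^ 15 + a ^ 14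
      + a ^ 13 + a ^ 12 + a ^ 11 + a ^ 10 + a ^ 9 + a ^ 8 + a ^ 7 + a ^ 6 + a ^ 5 + a ^ 4 + a
      ^ 3) * x ^ 18 + (a ^ 15 + a ^ 12 + a ^ 11 + a ^ 10 + a ^ 8 + a ^ 7 + a ^ 6 + a ^ 3) * x
      ^ 16 + (a ^ 12 + a ^ 11 + a ^ 10 + a ^ 9 + a ^ 6 + a ^ 5 + a ^ 4 + a ^ 3) * x ^ 14 + (a
      ^ 9 + a ^ 8 + a ^ 6 + a ^ 4 + a ^ 3) * x ^ 12) +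
    ((a ^ 14 + a ^ 12 + a ^ 10 + a ^ 8 + a ^ 6 + a ^ 4 + a ^ 2 + 1) * x ^ 14 + (a ^ 13 + a ^
      12 + a ^ 9 + a ^ 8 + a ^ 5 + a ^ 4 + a + 1) * x ^ 13 + (a ^ 10 + a ^ 8 + a ^ 2 + 1) * x
      ^ 10 + (a ^ 9 + a ^ 8 + a + 1) * x ^ 9) * y ^ 3 +
    ((a ^ 12 + a ^ 8 + a ^ 4 + 1) * x ^ 12 + (a ^ 10 + a ^ 8 + a ^ 2 + 1) * x ^ 10 + (a ^ 8 +
      1) * x ^ 8 + (a ^ 6 + a ^ 4 + a ^ 2 + 1) * x ^ 6) * y ^ 6 +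
    ((a ^ 10 + a ^ 8 + a ^ 2 + 1) * x ^ 10 + (a ^ 9 + a ^ 8 + a + 1) * x ^ 9 + (a ^ 8 + 1) * x
      ^ 8 + (a ^ 7 + a ^ 6 + a ^ 5 + a ^ 4 + a ^ 3 + a ^ 2 + a + 1) * x ^ 7 + (a ^ 6 + a ^ 4 +
      a ^ 2 + 1) * x ^ 6 + (a ^ 5 + a ^ 4 + a + 1) * x ^ 5 + (a ^ 4 + 1) * x ^ 4 + (a ^ 3 + a
      ^ 2 + a + 1) * x ^ 3) * y ^ 9 +
    ((a ^ 8 + 1) * x ^ 8 + 1) * y ^ 12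

def phiMe10 (a x y : R) : R :=
    (1) +
    ((a ^ 2 + 1) * x ^ 2 + 1) * y ^ 3

def phiMe11 (a x y : R) : R :=
    ((a ^ 12 + a ^ 11 + a ^ 4 + a ^ 3) * x ^ 12 + (a ^ 9 + a ^ 7 + a ^ 5 + a ^ 3) * x ^ 10 +
      (a ^ 6 + a ^ 5 + a ^ 4 + a ^ 3) * x ^ 8 + a ^ 3 * x ^ 6) +
    ((a ^ 9 + a) * x ^ 9 + (a ^ 8 + 1) * x ^ 8 + (a ^ 7 + a ^ 4 + a ^ 3 + 1) * x ^ 7 + (a ^ 5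
      + a) * x ^ 5 + (a ^ 4 + 1) * x ^ 4 + (a ^ 3 + 1) * x ^ 3) * y ^ 3 +
    ((a ^ 9 + a) * x ^ 9 + (a ^ 7 + a ^ 6 + a ^ 5 + a ^ 4 + a ^ 3 + a ^ 2 + a + 1) * x ^ 8 +
      (a ^ 7 + a ^ 4 + a ^ 3 + 1) * x ^ 7 + (a ^ 5 + a) * x ^ 6 + (a ^ 4 + 1) * x ^ 5 + (a ^ 4
      + a ^ 3 + a ^ 2 + a) * x ^ 4 + (a ^ 3 + 1) * x ^ 3 + a * x ^ 2 + (a + 1) * x + 1) * y ^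
      6 +
    ((a ^ 8 + 1) * x ^ 8 + (a ^ 7 + a ^ 6 + a ^ 5 + a ^ 4 + a ^ 3 + a ^ 2 + a + 1) * x ^ 7 +
      (a ^ 6 + a ^ 4 + a ^ 2 + 1) * x ^ 6 + (a ^ 5 + a ^ 4 + a + 1) * x ^ 5 + (a ^ 4 + 1) * x
      ^ 4 + (a ^ 3 + a ^ 2 + a + 1) * x ^ 3 + (a ^ 2 + 1) * x ^ 2 + (a + 1) * x) * y ^ 9 +
    ((a ^ 8 + 1) * x ^ 8 + 1) * y ^ 12

def phiMo00 (a x y : R) : R :=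
    ((a ^ 9 + a ^ 8 + a + 1) * x ^ 12 + (a ^ 8 + a ^ 7 + a ^ 5 + a ^ 3 + a + 1) * x ^ 10 + (a
      ^ 7 + a ^ 6 + a + 1) * x ^ 8 + (a ^ 6 + a ^ 5 + a ^ 3 + a + 1) * x ^ 6) +
    ((a ^ 7 + a ^ 6 + a ^ 5 + a ^ 4 + a ^ 3 + a ^ 2 + a + 1) * x ^ 8 + (a ^ 7 + a ^ 5 + a ^ 3
      + a) * x ^ 7 + (a ^ 6 + a ^ 2) * x ^ 6 + (a ^ 5 + a ^ 4 + a ^ 3 + a ^ 2) * x ^ 5 + (a ^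
      4 + a ^ 3 + a + 1) * x ^ 4 + (a ^ 2 + a) * x ^ 3) * y ^ 3 +
    ((a ^ 6 + a ^ 4 + a ^ 2 + 1) * x ^ 7 + (a ^ 6 + a ^ 5 + a ^ 2 + a) * x ^ 6 + (a ^ 3 + a ^
      2 + a + 1) * x ^ 5 + (a ^ 2 + 1) * x ^ 4 + (a ^ 3 + 1) * x ^ 3 + a * x ^ 2 + (a + 1) * x
      + 1) * y ^ 6 +
    ((a ^ 5 + a ^ 4 + a + 1) * x ^ 5 + (a + 1) * x) * y ^ 9 +
    ((a ^ 4 + 1) * x ^ 4 + 1) * y ^ 12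

def phiMo01 (a x y : R) : R :=
    ((a ^ 21 + a ^ 19 + a ^ 5 + a ^ 3) * x ^ 24 + (a ^ 20 + a ^ 4) * x ^ 22 + (a ^ 19 + a ^ 16
      + a ^ 12 + a ^ 8 + a ^ 4 + a ^ 3) * x ^ 20 + (a ^ 18 + a ^ 14 + a ^ 10 + a ^ 6) * x ^ 18
      + (a ^ 15 + a ^ 14 + a ^ 9 + a ^ 6 + a ^ 5 + a ^ 3) * x ^ 16 + (a ^ 12 + a ^ 10 + a ^ 6
      + a ^ 4) * x ^ 14 + (a ^ 9 + a ^ 8 + a ^ 6 + a ^ 4 + a ^ 3) * x ^ 12) +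
    ((a ^ 16 + 1) * x ^ 16 + (a ^ 15 + a ^ 14 + a ^ 13 + a ^ 12 + a ^ 11 + a ^ 10 + a ^ 9 + a
      ^ 8 + a ^ 7 + a ^ 6 + a ^ 5 + a ^ 4 + a ^ 3 + a ^ 2 + a + 1) * x ^ 15 + (a ^ 14 + a ^ 12
      + a ^ 10 + a ^ 8 + a ^ 6 + a ^ 4 + a ^ 2 + 1) * x ^ 14 + (a ^ 13 + a ^ 12 + a ^ 9 + a ^
      8 + a ^ 5 + a ^ 4 + a + 1) * x ^ 13 + (a ^ 12 + a ^ 8 + a ^ 4 + 1) * x ^ 12 + (a ^ 11 +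
      a ^ 10 + a ^ 9 + a ^ 8 + a ^ 3 + a ^ 2 + a + 1) * x ^ 11 + (a ^ 10 + a ^ 8 + a ^ 2 + 1)
      * x ^ 10 + (a ^ 9 + a ^ 8 + a + 1) * x ^ 9) * y ^ 3 +
    ((a ^ 12 + a ^ 8 + a ^ 4 + 1) * x ^ 12 + (a ^ 10 + a ^ 8 + a ^ 2 + 1) * x ^ 10 + (a ^ 8 +
      1) * x ^ 8 + (a ^ 6 + a ^ 4 + a ^ 2 + 1) * x ^ 6) * y ^ 6 +
    ((a ^ 8 + 1) * x ^ 8 + (a ^ 7 + a ^ 6 + a ^ 5 + a ^ 4 + a ^ 3 + a ^ 2 + a + 1) * x ^ 7 +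
      (a ^ 4 + 1) * x ^ 4 + (a ^ 3 + a ^ 2 + a + 1) * x ^ 3) * y ^ 9 +
    ((a ^ 4 + 1) * x ^ 4 + 1) * y ^ 12

def phiMo10 (a x y : R) : R :=
    (1) +
    ((a + 1) * x + 1) * y ^ 3

def phiMo11 (a x y : R) : R :=
    ((a ^ 12 + a ^ 11 + a ^ 4 + a ^ 3) * x ^ 12 + (a ^ 9 + a ^ 7 + a ^ 5 + a ^ 3) * x ^ 10 +
      (a ^ 6 + a ^ 5 + a ^ 4 + a ^ 3) * x ^ 8 + a ^ 3 * x ^ 6) +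
    ((a ^ 8 + a ^ 7 + a ^ 6 + a ^ 5 + a ^ 4 + a ^ 3 + a ^ 2 + a) * x ^ 8 + (a ^ 6 + a ^ 4 + a
      ^ 2 + 1) * x ^ 7 + (a ^ 6 + a ^ 2) * x ^ 6 + (a ^ 5 + a ^ 4 + a ^ 3 + a ^ 2) * x ^ 5 +
      (a ^ 3 + a) * x ^ 4 + (a ^ 3 + 1) * x ^ 3) * y ^ 3 +
    ((a ^ 7 + a ^ 5 + a ^ 3 + a) * x ^ 7 + (a ^ 5 + a ^ 4 + a + 1) * x ^ 6 + (a ^ 3 + a ^ 2 +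
      a + 1) * x ^ 5 + (a ^ 2 + 1) * x ^ 4 + (a ^ 2 + a) * x ^ 3 + (a ^ 2 + a + 1) * x ^ 2 +
      (a + 1) * x + 1) * y ^ 6 +
    ((a ^ 5 + a ^ 4 + a + 1) * x ^ 5 + (a + 1) * x) * y ^ 9 +
    ((a ^ 4 + 1) * x ^ 4 + 1) * y ^ 12

def phiWe00 (a x y : R) : R :=
    ((a ^ 9 + a ^ 8 + a + 1) * x ^ 12 + (a ^ 8 + a ^ 7 + a ^ 5 + a ^ 3 + a + 1) * x ^ 10 + (a
      ^ 7 + a ^ 6 + a + 1) * x ^ 8 + (a ^ 6 + a ^ 5 + a ^ 3 + a + 1) * x ^ 6) +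
    ((a ^ 8 + 1) * x ^ 9 + (a ^ 8 + 1) * x ^ 8 + (a ^ 6 + a ^ 5 + a ^ 2 + a) * x ^ 7 + (a ^ 4
      + 1) * x ^ 5 + (a ^ 4 + 1) * x ^ 4 + (a ^ 2 + a) * x ^ 3) * y ^ 3 +
    ((a ^ 8 + 1) * x ^ 9 + (a ^ 8 + a ^ 7 + a ^ 6 + a ^ 5 + a ^ 4 + a ^ 3 + a ^ 2 + a) * x ^ 8
      + (a ^ 6 + a ^ 5 + a ^ 2 + a) * x ^ 7 + (a ^ 6 + a ^ 5 + a ^ 4 + a ^ 2 + a + 1) * x ^ 6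
      + (a ^ 5 + a) * x ^ 5 + (a ^ 3 + a ^ 2 + a + 1) * x ^ 4 + (a ^ 2 + a) * x ^ 3 + (a ^ 2 +
      a + 1) * x ^ 2 + (a + 1) * x + 1) * y ^ 6 +
    ((a ^ 8 + 1) * x ^ 8 + (a ^ 7 + a ^ 6 + a ^ 5 + a ^ 4 + a ^ 3 + a ^ 2 + a + 1) * x ^ 7 +
      (a ^ 6 + a ^ 4 + a ^ 2 + 1) * x ^ 6 + (a ^ 5 + a ^ 4 + a + 1) * x ^ 5 + (a ^ 4 + 1) * x
      ^ 4 + (a ^ 3 + a ^ 2 + a + 1) * x ^ 3 + (a ^ 2 + 1) * x ^ 2 + (a + 1) * x) * y ^ 9 +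
    ((a ^ 8 + 1) * x ^ 8 + 1) * y ^ 12

def phiWe01 (a x y : R) : R :=
    ((a ^ 18 + a ^ 16 + a ^ 2 + 1) * x ^ 24 + (a ^ 17 + a ^ 16 + a + 1) * x ^ 22 + (a ^ 16 + a
      ^ 15 + a ^ 14 + a ^ 13 + a ^ 11 + a ^ 10 + a ^ 9 + a ^ 7 + a ^ 6 + a ^ 5 + a ^ 3 + a ^ 2
      + a + 1) * x ^ 20 + (a ^ 15 + a ^ 14 + a ^ 13 + a ^ 12 + a ^ 11 + a ^ 10 + a ^ 9 + a ^ 8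
      + a ^ 7 + a ^ 6 + a ^ 5 + a ^ 4 + a ^ 3 + a ^ 2 + a + 1) * x ^ 18 + (a ^ 13 + a ^ 10 + a
      ^ 9 + a ^ 8 + a ^ 6 + a ^ 5 + a ^ 4 + a) * x ^ 16 + (a ^ 11 + a ^ 10 + a ^ 9 + a ^ 8 + a
      ^ 5 + a ^ 4 + a ^ 3 + a ^ 2) * x ^ 14 + (a ^ 9 + a ^ 8 + a ^ 6 + a ^ 4 + a ^ 3) * x ^
      12) +
    ((a ^ 14 + a ^ 12 + a ^ 10 + a ^ 8 + a ^ 6 + a ^ 4 + a ^ 2 + 1) * x ^ 14 + (a ^ 13 + a ^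
      12 + a ^ 9 + a ^ 8 + a ^ 5 + a ^ 4 + a + 1) * x ^ 13 + (a ^ 10 + a ^ 8 + a ^ 2 + 1) * x
      ^ 10 + (a ^ 9 + a ^ 8 + a + 1) * x ^ 9) * y ^ 3 +
    ((a ^ 12 + a ^ 8 + a ^ 4 + 1) * x ^ 12 + (a ^ 10 + a ^ 8 + a ^ 2 + 1) * x ^ 10 + (a ^ 8 +
      1) * x ^ 8 + (a ^ 6 + a ^ 4 + a ^ 2 + 1) * x ^ 6) * y ^ 6 +
    ((a ^ 10 + a ^ 8 + a ^ 2 + 1) * x ^ 10 + (a ^ 9 + a ^ 8 + a + 1) * x ^ 9 + (a ^ 8 + 1) * x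
      ^ 8 + (a ^ 7 + a ^ 6 + a ^ 5 + a ^ 4 + a ^ 3 + a ^ 2 + a + 1) * x ^ 7 + (a ^ 6 + a ^ 4 +
      a ^ 2 + 1) * x ^ 6 + (a ^ 5 + a ^ 4 + a + 1) * x ^ 5 + (a ^ 4 + 1) * x ^ 4 + (a ^ 3 + a
      ^ 2 + a + 1) * x ^ 3) * y ^ 9 +
    ((a ^ 8 + 1) * x ^ 8 + 1) * y ^ 12

def phiWe10 (a x y : R) : R :=
    (1) +
    ((a ^ 2 + 1) * x ^ 2 + 1) * y ^ 3

def phiWe11 (a x y : R) : R :=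
    ((a ^ 9 + a ^ 8 + a + 1) * x ^ 12 + (a ^ 7 + a ^ 5 + a ^ 3 + a) * x ^ 10 + (a ^ 5 + a ^ 4
      + a ^ 3 + a ^ 2) * x ^ 8 + a ^ 3 * x ^ 6) +
    ((a ^ 8 + 1) * x ^ 9 + (a ^ 8 + 1) * x ^ 8 + (a ^ 7 + a ^ 4 + a ^ 3 + 1) * x ^ 7 + (a ^ 4
      + 1) * x ^ 5 + (a ^ 4 + 1) * x ^ 4 + (a ^ 3 + 1) * x ^ 3) * y ^ 3 +
    ((a ^ 8 + 1) * x ^ 9 + (a ^ 8 + a ^ 7 + a ^ 6 + a ^ 5 + a ^ 4 + a ^ 3 + a ^ 2 + a) * x ^ 8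
      + (a ^ 7 + a ^ 4 + a ^ 3 + 1) * x ^ 7 + (a ^ 5 + a) * x ^ 6 + (a ^ 5 + a) * x ^ 5 + (a ^
      3 + a ^ 2 + a + 1) * x ^ 4 + (a ^ 3 + 1) * x ^ 3 + a * x ^ 2 + (a + 1) * x + 1) * y ^ 6 +
    ((a ^ 8 + 1) * x ^ 8 + (a ^ 7 + a ^ 6 + a ^ 5 + a ^ 4 + a ^ 3 + a ^ 2 + a + 1) * x ^ 7 +
      (a ^ 6 + a ^ 4 + a ^ 2 + 1) * x ^ 6 + (a ^ 5 + a ^ 4 + a + 1) * x ^ 5 + (a ^ 4 + 1) * x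
      ^ 4 + (a ^ 3 + a ^ 2 + a + 1) * x ^ 3 + (a ^ 2 + 1) * x ^ 2 + (a + 1) * x) * y ^ 9 +
    ((a ^ 8 + 1) * x ^ 8 + 1) * y ^ 12

def phiWo00 (a x y : R) : R :=
    ((a ^ 12 + a ^ 11 + a ^ 4 + a ^ 3) * x ^ 12 + (a ^ 10 + a ^ 9 + a ^ 7 + a ^ 5 + a ^ 3 + a
      ^ 2) * x ^ 10 + (a ^ 8 + a ^ 7 + a ^ 2 + a) * x ^ 8 + (a ^ 6 + a ^ 5 + a ^ 3 + a + 1) *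
      x ^ 6) +
    ((a ^ 8 + a ^ 7 + a ^ 6 + a ^ 5 + a ^ 4 + a ^ 3 + a ^ 2 + a) * x ^ 8 + (a ^ 6 + a ^ 4 + a
      ^ 2 + 1) * x ^ 7 + (a ^ 4 + 1) * x ^ 6 + (a ^ 3 + a ^ 2 + a + 1) * x ^ 5 + (a ^ 4 + a ^
      3 + a + 1) * x ^ 4 + (a ^ 2 + a) * x ^ 3) * y ^ 3 +
    ((a ^ 7 + a ^ 5 + a ^ 3 + a) * x ^ 7 + (a ^ 5 + a ^ 4 + a + 1) * x ^ 6 + (a ^ 5 + a ^ 4 +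
      a ^ 3 + a ^ 2) * x ^ 5 + (a ^ 4 + a ^ 2) * x ^ 4 + (a ^ 3 + 1) * x ^ 3 + a * x ^ 2 + (a
      + 1) * x + 1) * y ^ 6 +
    ((a ^ 5 + a ^ 4 + a + 1) * x ^ 5 + (a + 1) * x) * y ^ 9 +
    ((a ^ 4 + 1) * x ^ 4 + 1) * y ^ 12

def phiWo01 (a x y : R) : R :=
    ((a ^ 21 + a ^ 19 + a ^ 5 + a ^ 3) * x ^ 24 + (a ^ 18 + a ^ 2) * x ^ 22 + (a ^ 17 + a ^ 16
      + a ^ 12 + a ^ 8 + a ^ 4 + a) * x ^ 20 + (a ^ 12 + a ^ 8 + a ^ 4 + 1) * x ^ 18 + (a ^ 13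
      + a ^ 11 + a ^ 10 + a ^ 7 + a ^ 2 + a) * x ^ 16 + (a ^ 10 + a ^ 8 + a ^ 4 + a ^ 2) * x ^
      14 + (a ^ 9 + a ^ 8 + a ^ 6 + a ^ 4 + a ^ 3) * x ^ 12) +
    ((a ^ 16 + 1) * x ^ 16 + (a ^ 15 + a ^ 14 + a ^ 13 + a ^ 12 + a ^ 11 + a ^ 10 + a ^ 9 + a
      ^ 8 + a ^ 7 + a ^ 6 + a ^ 5 + a ^ 4 + a ^ 3 + a ^ 2 + a + 1) * x ^ 15 + (a ^ 14 + a ^ 12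
      + a ^ 10 + a ^ 8 + a ^ 6 + a ^ 4 + a ^ 2 + 1) * x ^ 14 + (a ^ 13 + a ^ 12 + a ^ 9 + a ^
      8 + a ^ 5 + a ^ 4 + a + 1) * x ^ 13 + (a ^ 12 + a ^ 8 + a ^ 4 + 1) * x ^ 12 + (a ^ 11 +
      a ^ 10 + a ^ 9 + a ^ 8 + a ^ 3 + a ^ 2 + a + 1) * x ^ 11 + (a ^ 10 + a ^ 8 + a ^ 2 + 1)
      * x ^ 10 + (a ^ 9 + a ^ 8 + a + 1) * x ^ 9) * y ^ 3 +
    ((a ^ 12 + a ^ 8 + a ^ 4 + 1) * x ^ 12 + (a ^ 10 + a ^ 8 + a ^ 2 + 1) * x ^ 10 + (a ^ 8 +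
      1) * x ^ 8 + (a ^ 6 + a ^ 4 + a ^ 2 + 1) * x ^ 6) * y ^ 6 +
    ((a ^ 8 + 1) * x ^ 8 + (a ^ 7 + a ^ 6 + a ^ 5 + a ^ 4 + a ^ 3 + a ^ 2 + a + 1) * x ^ 7 +
      (a ^ 4 + 1) * x ^ 4 + (a ^ 3 + a ^ 2 + a + 1) * x ^ 3) * y ^ 9 +
    ((a ^ 4 + 1) * x ^ 4 + 1) * y ^ 12

def phiWo10 (a x y : R) : R :=
    (1) +
    ((a + 1) * x + 1) * y ^ 3

def phiWo11 (a x y : R) : R :=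
    ((a ^ 9 + a ^ 8 + a + 1) * x ^ 12 + (a ^ 7 + a ^ 5 + a ^ 3 + a) * x ^ 10 + (a ^ 5 + a ^ 4
      + a ^ 3 + a ^ 2) * x ^ 8 + a ^ 3 * x ^ 6) +
    ((a ^ 7 + a ^ 6 + a ^ 5 + a ^ 4 + a ^ 3 + a ^ 2 + a + 1) * x ^ 8 + (a ^ 7 + a ^ 5 + a ^ 3
      + a) * x ^ 7 + (a ^ 4 + 1) * x ^ 6 + (a ^ 3 + a ^ 2 + a + 1) * x ^ 5 + (a ^ 3 + a) * x ^
      4 + (a ^ 3 + 1) * x ^ 3) * y ^ 3 +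
    ((a ^ 6 + a ^ 4 + a ^ 2 + 1) * x ^ 7 + (a ^ 6 + a ^ 5 + a ^ 2 + a) * x ^ 6 + (a ^ 5 + a ^
      4 + a ^ 3 + a ^ 2) * x ^ 5 + (a ^ 4 + a ^ 2) * x ^ 4 + (a ^ 2 + a) * x ^ 3 + (a ^ 2 + a
      + 1) * x ^ 2 + (a + 1) * x + 1) * y ^ 6 +
    ((a ^ 5 + a ^ 4 + a + 1) * x ^ 5 + (a + 1) * x) * y ^ 9 +
    ((a ^ 4 + 1) * x ^ 4 + 1) * y ^ 12

end Phi

/-! ## The four limit matrices and the truncation identities -/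

/-- The field `𝔽₂(a)`. -/
abbrev F2a : Type := RatFunc (ZMod 2)

/-- The formal variable `a` of `𝔽₂(a)`. -/
noncomputable def fa : F2a := RatFunc.X

/-- The matrix whose `(i, j)` entry is the unique root of `φ a x · i j` in `𝔽₂(a)⟦x⟧` with initial
terms `[c₀ i j, c₁ i j]`. -/
noncomputable def solutionMatrix
    (φ : F2a⟦X⟧ → F2a⟦X⟧ → F2a⟦X⟧ → Matrix (Fin 2) (Fin 2) F2a⟦X⟧)
    (c₀ c₁ : Matrix (Fin 2) (Fin 2) F2a) : Matrix (Fin 2) (Fin 2) F2a⟦X⟧ :=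
  Matrix.of fun i j =>
    uniqueSolution (fun y => φ (PowerSeries.C fa) PowerSeries.X y i j) (c₀ i j) (c₁ i j)

/-- The matrix `Mᵉ`. -/
noncomputable def matMe : Matrix (Fin 2) (Fin 2) F2a⟦X⟧ :=
  solutionMatrix (fun a x y => !![phiMe00 a x y, phiMe01 a x y; phiMe10 a x y, phiMe11 a x y])
    !![1, 0; 1, 0] !![fa, fa; 0, fa]

/-- The matrix `Mᵒ`. -/
noncomputable def matMo : Matrix (Fin 2) (Fin 2) F2a⟦X⟧ :=
  solutionMatrix (fun a x y => !![phiMo00 a x y, phiMo01 a x y; phiMo10 a x y, phiMo11 a x y])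
    !![1, 0; 1, 0] !![fa, fa; fa + 1, fa]

/-- The matrix `Wᵉ`. -/
noncomputable def matWe : Matrix (Fin 2) (Fin 2) F2a⟦X⟧ :=
  solutionMatrix (fun a x y => !![phiWe00 a x y, phiWe01 a x y; phiWe10 a x y, phiWe11 a x y])
    !![1, 0; 1, 0] !![1, 1; 0, 1]

/-- The matrix `Wᵒ`. -/
noncomputable def matWo : Matrix (Fin 2) (Fin 2) F2a⟦X⟧ :=
  solutionMatrix (fun a x y => !![phiWo00 a x y, phiWo01 a x y; phiWo10 a x y, phiWo11 a x y])
    !![1, 0; 1, 0] !![1, 1; fa + 1, 1]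

/-- `Mₙ`, the product over the first `2ⁿ` terms of the `(a, 1)`-Thue–Morse sequence. -/
noncomputable def matM (n : ℕ) : Matrix (Fin 2) (Fin 2) F2a⟦X⟧ :=
  stieltjesProd (thueMorse fa 1) (2 ^ n)

/-- `Wₙ`, the product over the first `2ⁿ` terms of the `(1, a)`-Thue–Morse sequence. -/
noncomputable def matW (n : ℕ) : Matrix (Fin 2) (Fin 2) F2a⟦X⟧ :=
  stieltjesProd (thueMorse 1 fa) (2 ^ n)

/-- The matrix `a^{u/2} x^u I₂`. -/
noncomputable def diagTerm (u : ℕ) : Matrix (Fin 2) (Fin 2) F2a⟦X⟧ :=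
  (PowerSeries.C (fa ^ (u / 2)) * PowerSeries.X ^ u) • 1

/-- The truncation identities: for `k ≥ 2` and `u = 2^{2k-1}`, `M_{2k}` and `W_{2k}` are
`Mᵉ[:u] + a^{u/2} x^u I₂` and `Wᵉ[:u] + a^{u/2} x^u I₂`; for `k ≥ 2` and `u = 2^{2k}`, `M_{2k+1}`
and `W_{2k+1}` are `Mᵒ[:u] + a^{u/2} x^u I₂` and `Wᵒ[:u] + a^{u/2} x^u I₂`. -/
def TruncationIdentities : Prop :=
  (∀ k u : ℕ, 2 ≤ k → u = 2 ^ (2 * k - 1) →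
    matM (2 * k) = truncMatrix u matMe + diagTerm u ∧
    matW (2 * k) = truncMatrix u matWe + diagTerm u) ∧
  (∀ k u : ℕ, 2 ≤ k → u = 2 ^ (2 * k) →
    matM (2 * k + 1) = truncMatrix u matMo + diagTerm u ∧
    matW (2 * k + 1) = truncMatrix u matWo + diagTerm u)

/-! ## The quartic -/

/-- The element `a` of `𝔽₂(a)(x)`. -/
noncomputable def ca : RatFunc F2a := RatFunc.C fa

/-- The coefficient `p₀(x)`. -/
noncomputable def quarticP0 : RatFunc F2a :=
  (ca ^ 2 + 1) / ca ^ 4 * RatFunc.X ^ 2 + 1 / (ca ^ 5 + ca ^ 4)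

/-- The coefficient `p₁(x)`. -/
noncomputable def quarticP1 : RatFunc F2a :=
  (ca + 1) / ca ^ 5 * RatFunc.X + 1 / ca ^ 5

/-- The coefficient `p₂(x)`. -/
noncomputable def quarticP2 : RatFunc F2a :=
  1 / ca ^ 5 * RatFunc.X + 1 / (ca ^ 6 + ca ^ 5)

/-- The coefficient `p₄(x)`. -/
noncomputable def quarticP4 : RatFunc F2a :=
  1 / (ca ^ 6 + ca ^ 5) * RatFunc.X ^ 2

/-- The quartic `p₀ + p₁ y + p₂ y² + p₄ y⁴` over `𝔽₂(a)(x)`. -/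
noncomputable def quartic : Polynomial (RatFunc F2a) :=
  Polynomial.C quarticP0 + Polynomial.C quarticP1 * Polynomial.X +
    Polynomial.C quarticP2 * Polynomial.X ^ 2 + Polynomial.C quarticP4 * Polynomial.X ^ 4

/-- The Stieltjes continued fraction of the `(a, 1)`-Thue–Morse sequence, as an element of the
field `𝔽₂(a)((x))`, which is an extension of `𝔽₂(a)(x)`. -/
noncomputable def stieltjesTM : F2a⸨X⸩ := ((stieltjes (thueMorse fa 1) : F2a⟦X⟧) : F2a⸨X⸩)

/-! Write `b = a + 1`, `t = bx`, `s = 1 + t`, `c = ax²(b³x² + 1)`. Clearing denominators turns the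
quartic into `x²y⁴ + sy² + bsy + a(b³x² + 1)`. At `x = 0` this is `(y + 1)(y + a)`, so Hensel's
lemma gives a power series root `g` with constant term `a`; the point is that `g` is the continued
fraction.

The first row `(P, Q)` of a product of `n + 1` factors satisfies `Q = x · (finite continued
fraction) · P`. By the truncation identities for `M_{2k}`, in the limit `Mᵉ₀₁ = x · Stiel · Mᵉ₀₀`.
It remains to compute these two entries. Put `w = xg` and `T = Mᵉ₁₀`, so that `s²T³ = 1`. In
characteristic 2, `T(1 + w)` and `Tw(1 + w)` are roots of `phiMe00` and `phiMe01` with the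
prescribed initial terms (`phiMe00_eq_zero`, `phiMe01_eq_zero`). By uniqueness they are `Mᵉ₀₀` and
`Mᵉ₀₁`, whose quotient is `xg`; hence `Stiel = g` (`stieltjes_quartic`).

For minimality, the quartic is irreducible by a generalized Eisenstein criterion at the prime `s` of
`𝔽₂(a)[x]`: modulo `s` it is a constant times the square of `q = y² - ab`, where `ab` is not a
square in `𝔽₂(a)`, and its remainder modulo `q` is not divisible by `s²`. -/

/-! ### Roots of the polynomials for the entries of `Mᵉ` -/

section CharTwo

variable {R : Type*} [CommRing R] [CharP R 2]

/-- The powers of `s` are arranged so that substituting `y = Tu` with `s²T³ = 1` leaves the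
polynomial in `u³` of `cube_root_quartic_of_quartic`. -/
theorem phiMe00_eq_factored (a x y t s e : R) (ht : t = (a + 1) * x) (hs : s = 1 + t)
    (he : e = t ^ 2 + a * x ^ 2 * ((a + 1) ^ 3 * x ^ 2 + 1)) :
    phiMe00 a x y = e ^ 3 + s ^ 4 * (t * (t ^ 2 * s + e)) * y ^ 3 +
      s ^ 5 * (t ^ 2 * s + s ^ 2 + e) * y ^ 6 + s ^ 7 * t * y ^ 9 + s ^ 8 * y ^ 12 := by
  subst he hs ht
  unfold phiMe00
  grind

theorem phiMe01_eq_factored (a x y t s c : R) (ht : t = (a + 1) * x) (hs : s = 1 + t)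
    (hc : c = a * x ^ 2 * ((a + 1) ^ 3 * x ^ 2 + 1)) :
    phiMe01 a x y = (c ^ 2 + c * t ^ 2) ^ 3 + s ^ 5 * t ^ 9 * y ^ 3 +
      s ^ 6 * t ^ 6 * y ^ 6 + s ^ 7 * t ^ 3 * y ^ 9 + s ^ 8 * y ^ 12 := by
  subst hc hs ht
  unfold phiMe01
  grind
end CharTwo

section CharTwo

variable {R : Type*} [CommRing R] [CharP R 2]

/-- The norm form `e³ + s³v² + α³v + eαsv` of `e + αu + su²` with `v = u³`, `α = v + ts`. -/
theorem cube_root_quartic_of_quartic (u t s e : R) (h : u ^ 4 + s * u ^ 2 + t * s * u + e = 0) :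
    e ^ 3 + s ^ 2 * (t * (t ^ 2 * s + e)) * u ^ 3 + s * (t ^ 2 * s + s ^ 2 + e) * (u ^ 3) ^ 2 +
      s * t * (u ^ 3) ^ 3 + (u ^ 3) ^ 4 = 0 := by
  obtain rfl : e = u ^ 4 + s * u ^ 2 + t * s * u := by grind
  grind

theorem phiMe00_eq_zero (a x T w t s : R) (ht : t = (a + 1) * x) (hs : s = 1 + t)
    (hw : w ^ 4 + s * w ^ 2 + t * s * w + a * x ^ 2 * ((a + 1) ^ 3 * x ^ 2 + 1) = 0)
    (hT : s ^ 2 * T ^ 3 = 1) : phiMe00 a x (T * (1 + w)) = 0 := by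
  -- The shift `w ↦ 1 + w` changes the constant term by `1 + s + ts = t²`, which is why `e = t² +
  -- c`.
  have hu : (1 + w) ^ 4 + s * (1 + w) ^ 2 + t * s * (1 + w) +
      (t ^ 2 + a * x ^ 2 * ((a + 1) ^ 3 * x ^ 2 + 1)) = 0 := by grind
  have key := cube_root_quartic_of_quartic _ _ _ _ hu
  rw [phiMe00_eq_factored a x _ t s _ ht hs rfl]
  generalize t ^ 2 + a * x ^ 2 * ((a + 1) ^ 3 * x ^ 2 + 1) = e at *
  generalize 1 + w = u at *
  have h₂ : (s ^ 2 * T ^ 3) ^ 2 = 1 := by rw [hT, one_pow]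
  have h₃ : (s ^ 2 * T ^ 3) ^ 3 = 1 := by rw [hT, one_pow]
  have h₄ : (s ^ 2 * T ^ 3) ^ 4 = 1 := by rw [hT, one_pow]
  linear_combination key + s ^ 2 * (t * (t ^ 2 * s + e)) * u ^ 3 * hT +
    s * (t ^ 2 * s + s ^ 2 + e) * (u ^ 3) ^ 2 * h₂ + s * t * (u ^ 3) ^ 3 * h₃ + (u ^ 3) ^ 4 * h₄

/-- The polynomial `L(w) = w⁴ + sw² + tsw` is additive, with `L(w) = c` and `L(1) = t²`. Hence `L² +
t²L` is additive and vanishes at `1`, so it is a polynomial in `z = w² + w`, namely `z⁴ + st³z`.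
Substituting `y = Tz` in the factored form leaves `(c² + ct²)³ + (z⁴ + st³z)³`, which is zero. -/
theorem phiMe01_eq_zero (a x T w t s : R) (ht : t = (a + 1) * x) (hs : s = 1 + t)
    (hw : w ^ 4 + s * w ^ 2 + t * s * w + a * x ^ 2 * ((a + 1) ^ 3 * x ^ 2 + 1) = 0)
    (hT : s ^ 2 * T ^ 3 = 1) : phiMe01 a x (T * (w * (1 + w))) = 0 := by
  rw [phiMe01_eq_factored a x _ t s _ ht hs rfl]
  generalize a * x ^ 2 * ((a + 1) ^ 3 * x ^ 2 + 1) = c at *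
  have hz : (w * (1 + w)) ^ 4 + s * t ^ 3 * (w * (1 + w)) = c ^ 2 + c * t ^ 2 := by
    obtain rfl : c = w ^ 4 + s * w ^ 2 + t * s * w := by grind
    subst hs
    grind
  generalize w * (1 + w) = z at *
  rw [← hz]
  have h₂ : (s ^ 2 * T ^ 3) ^ 2 = 1 := by rw [hT, one_pow]
  have h₃ : (s ^ 2 * T ^ 3) ^ 3 = 1 := by rw [hT, one_pow]
  have h₄ : (s ^ 2 * T ^ 3) ^ 4 = 1 := by rw [hT, one_pow]
  have key : (z ^ 4 + s * t ^ 3 * z) ^ 3 + s ^ 3 * t ^ 9 * z ^ 3 + s ^ 2 * t ^ 6 * z ^ 6 +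
      s * t ^ 3 * z ^ 9 + z ^ 12 = 0 := by grind
  linear_combination key + s ^ 3 * t ^ 9 * z ^ 3 * hT + s ^ 2 * t ^ 6 * z ^ 6 * h₂ +
    s * t ^ 3 * z ^ 9 * h₃ + z ^ 12 * h₄

theorem sq_mul_cube_of_phiMe10_eq_zero (a x T t s : R) (ht : t = (a + 1) * x) (hs : s = 1 + t)
    (h : phiMe10 a x T = 0) : s ^ 2 * T ^ 3 = 1 := by
  rw [phiMe10] at h
  grind

end CharTwo

/-! ### Continued fractions as matrix products; unique solutions -/

section Stieltjes

variable {K : Type*} [Field K]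

/-- Splitting off the rightmost factor matches the recursion of `stieltjesFin`, which splits off `t
0` and shifts the sequence. -/
theorem stieltjesProd_succ_eq_mul (t : ℕ → K) (n : ℕ) :
    stieltjesProd t (n + 1) = stieltjesProd (fun j => t (j + 1)) n *
      !![1, PowerSeries.C (t 0) * PowerSeries.X; 1, 0] := by
  induction n with
  | zero => simp [stieltjesProd]
  | succ n ih =>
    rw [stieltjesProd, ih, stieltjesProd, Matrix.mul_assoc]

/-- If `(p, q)` is the first row for the shifted sequence, multiplying on the right by the factor of
`t 0` gives `(p + q, t₀xp)`, with quotient `t₀x / (1 + q/p)`: one more level of the continued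
fraction. The index `n` uses the `n + 1` terms `t 0, …, t n`. -/
theorem X_mul_stieltjesFin_mul (n : ℕ) : ∀ t : ℕ → K,
    PowerSeries.X * stieltjesFin t n * stieltjesProd t (n + 1) 0 0 =
      stieltjesProd t (n + 1) 0 1 := by
  induction n with
  | zero => intro t; simp [stieltjesProd, stieltjesFin, mul_comm]
  | succ n ih =>
    intro t
    have h := ih fun j => t (j + 1)
    rw [stieltjesProd_succ_eq_mul, stieltjesFin]
    simp only [Matrix.mul_apply, Fin.sum_univ_two, Matrix.of_apply, Matrix.cons_val_zero,
      Matrix.cons_val_one, Matrix.cons_val', Matrix.cons_val_fin_one, mul_one, mul_zero, add_zero]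
    rw [← h]
    have hu : (1 + PowerSeries.X * stieltjesFin (fun j => t (j + 1)) n) *
        (1 + PowerSeries.X * stieltjesFin (fun j => t (j + 1)) n)⁻¹ = 1 :=
      PowerSeries.mul_inv_cancel _ (by simp)
    linear_combination PowerSeries.X * PowerSeries.C (t 0) *
      stieltjesProd (fun j => t (j + 1)) (n + 1) 0 0 * hu

theorem constantCoeff_stieltjesProd_col_zero (t : ℕ → K) (n : ℕ) :
    PowerSeries.constantCoeff (stieltjesProd t (n + 1) 0 0) = 1 ∧
      PowerSeries.constantCoeff (stieltjesProd t (n + 1) 1 0) = 1 := by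
  induction n with
  | zero => simp [stieltjesProd]
  | succ n ih =>
    rw [stieltjesProd]
    simp [Matrix.mul_apply, Fin.sum_univ_two, ih.1]

theorem X_pow_dvd_stieltjes_sub (u : ℕ → K) (n : ℕ) :
    (PowerSeries.X : K⟦X⟧) ^ (n + 1) ∣ stieltjes u - stieltjesFin u n := by
  rw [PowerSeries.X_pow_dvd_iff]
  intro m hm
  rw [map_sub, coeff_stieltjesFin u (by omega), sub_self]

theorem constantCoeff_stieltjes (u : ℕ → K) : PowerSeries.constantCoeff (stieltjes u) = u 0 := by
  rw [← PowerSeries.coeff_zero_eq_constantCoeff_apply, ← coeff_stieltjesFin u le_rfl]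
  simp [stieltjesFin]

/-- The default value is `0`, so a nonzero value certifies that the equation has exactly one
solution with the given initial terms. -/
theorem uniqueSolution_spec {φ : K⟦X⟧ → K⟦X⟧} {c₀ c₁ : K} (h : uniqueSolution φ c₀ c₁ ≠ 0) :
    φ (uniqueSolution φ c₀ c₁) = 0 ∧ PowerSeries.coeff 0 (uniqueSolution φ c₀ c₁) = c₀ ∧
      PowerSeries.coeff 1 (uniqueSolution φ c₀ c₁) = c₁ := by
  by_cases h' : ∃! y : K⟦X⟧, φ y = 0 ∧ PowerSeries.coeff 0 y = c₀ ∧ PowerSeries.coeff 1 y = c₁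
  · rw [uniqueSolution, dif_pos h']
    exact h'.choose_spec.1
  · exact absurd (dif_neg h') h

theorem uniqueSolution_eq {φ : K⟦X⟧ → K⟦X⟧} {c₀ c₁ : K} (h : uniqueSolution φ c₀ c₁ ≠ 0)
    {y : K⟦X⟧} (hy : φ y = 0) (h₀ : PowerSeries.coeff 0 y = c₀)
    (h₁ : PowerSeries.coeff 1 y = c₁) : uniqueSolution φ c₀ c₁ = y := by
  by_cases h' : ∃! y : K⟦X⟧, φ y = 0 ∧ PowerSeries.coeff 0 y = c₀ ∧ PowerSeries.coeff 1 y = c₁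
  · rw [uniqueSolution, dif_pos h']
    exact (h'.choose_spec.2 y ⟨hy, h₀, h₁⟩).symm
  · exact absurd (dif_neg h') h

theorem X_pow_dvd_truncMatrix_sub (u : ℕ) (T : Matrix (Fin 2) (Fin 2) K⟦X⟧) (i j : Fin 2) :
    (PowerSeries.X : K⟦X⟧) ^ u ∣ truncMatrix u T i j - T i j := by
  rw [PowerSeries.X_pow_dvd_iff]
  intro m hm
  simp [truncMatrix, PowerSeries.coeff_trunc, hm]

theorem PowerSeries.eq_zero_of_forall_X_pow_dvd {f : K⟦X⟧}
    (h : ∀ n, ∃ m ≥ n, (PowerSeries.X : K⟦X⟧) ^ m ∣ f) : f = 0 := by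
  ext n
  obtain ⟨m, hm, hd⟩ := h (n + 1)
  simpa using PowerSeries.X_pow_dvd_iff.1 hd n (by omega)

end Stieltjes

/-! ### Irreducibility of the quartic -/

theorem fa_ne_zero : fa ≠ 0 := RatFunc.X_ne_zero

theorem fa_add_one_ne_zero : fa + 1 ≠ 0 := by
  have h : (Polynomial.X + Polynomial.C 1 : Polynomial (ZMod 2)) ≠ 0 :=
    Polynomial.X_add_C_ne_zero 1
  have h' := (map_ne_zero_iff _ (RatFunc.algebraMap_injective (ZMod 2))).2 h
  simpa [fa] using h'

/-- A square root would be integral over `𝔽₂[a]`, hence a polynomial; but squares have derivative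
`0` in characteristic 2, while `a² + a` has derivative `1`. -/
theorem not_isSquare_fa_mul : ¬ ∃ r : F2a, r ^ 2 = fa * (fa + 1) := by
  rintro ⟨r, hr⟩
  have hint : IsIntegral (Polynomial (ZMod 2)) r := by
    refine IsIntegral.of_pow (n := 2) (by norm_num) ?_
    rw [hr]
    have : fa * (fa + 1) = algebraMap (Polynomial (ZMod 2)) F2a
        (Polynomial.X * (Polynomial.X + 1)) := by simp [fa]
    rw [this]
    exact isIntegral_algebraMap
  obtain ⟨p, rfl⟩ := IsIntegrallyClosed.isIntegral_iff.1 hint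
  have hp : p ^ 2 = Polynomial.X * (Polynomial.X + 1) := by
    apply RatFunc.algebraMap_injective (ZMod 2)
    rw [map_pow, hr]
    simp [fa]
  have hd := congrArg Polynomial.derivative hp
  have h₂ : (Polynomial.C 2 : Polynomial (ZMod 2)) = 0 := by
    rw [show (2 : ZMod 2) = 0 from rfl, map_zero]
  have h₂' : (2 : Polynomial (ZMod 2)) = 0 := CharTwo.two_eq_zero
  simp only [Polynomial.derivative_pow, Polynomial.derivative_mul, Polynomial.derivative_X,
    Polynomial.derivative_add, Polynomial.derivative_one, Nat.cast_ofNat, h₂] at hd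
  have : (1 : Polynomial (ZMod 2)) = 0 := by linear_combination -hd - Polynomial.X * h₂'
  exact one_ne_zero this

instance : CharP F2a 2 :=
  charP_of_injective_algebraMap (algebraMap (ZMod 2) F2a).injective 2

theorem F2a.two_eq_zero : (2 : F2a) = 0 := CharTwo.two_eq_zero

instance : CharP F2a⟦X⟧ 2 :=
  charP_of_injective_ringHom (f := (PowerSeries.C : F2a →+* F2a⟦X⟧)) PowerSeries.C_injective 2

/-- The quartic with denominators cleared, over `𝔽₂(a)[x]`. -/
noncomputable def integralQuartic : Polynomial (Polynomial F2a) :=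
  Polynomial.C (Polynomial.X ^ 2) * Polynomial.X ^ 4 +
    Polynomial.C (1 + Polynomial.C (fa + 1) * Polynomial.X) * Polynomial.X ^ 2 +
    Polynomial.C (Polynomial.C (fa + 1) * (1 + Polynomial.C (fa + 1) * Polynomial.X)) *
      Polynomial.X +
    Polynomial.C (Polynomial.C fa * (Polynomial.C ((fa + 1) ^ 3) * Polynomial.X ^ 2 + 1))

theorem natDegree_integralQuartic : integralQuartic.natDegree = 4 := by
  unfold integralQuartic
  compute_degree!

theorem leadingCoeff_integralQuartic : integralQuartic.leadingCoeff = Polynomial.X ^ 2 := by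
  rw [Polynomial.leadingCoeff, natDegree_integralQuartic]
  simp [integralQuartic, Polynomial.coeff_X_pow, -map_mul, -map_add, -map_pow]

/-- A common divisor of `x²` and `a(b³x² + 1)` divides the unit `a`. -/
theorem isPrimitive_integralQuartic : integralQuartic.IsPrimitive := by
  intro r hr
  rw [Polynomial.C_dvd_iff_dvd_coeff] at hr
  have h₄ := hr 4
  have h₀ := hr 0
  have e₄ : integralQuartic.coeff 4 = Polynomial.X ^ 2 := by
    rw [← natDegree_integralQuartic]; exact leadingCoeff_integralQuartic
  have e₀ : integralQuartic.coeff 0 =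
      Polynomial.C fa * (Polynomial.C ((fa + 1) ^ 3) * Polynomial.X ^ 2 + 1) := by
    simp [integralQuartic, -map_mul, -map_add, -map_pow]
  rw [e₄] at h₄
  rw [e₀] at h₀
  have h : r ∣ Polynomial.C fa := by
    have := dvd_sub h₀ (h₄.mul_left (Polynomial.C fa * Polynomial.C ((fa + 1) ^ 3)))
    convert this using 1
    ring
  exact isUnit_of_dvd_unit h (Polynomial.isUnit_C.2 fa_ne_zero.isUnit)

theorem irreducible_X_sq_sub :
    Irreducible (Polynomial.X ^ 2 - Polynomial.C (fa * (fa + 1)) : Polynomial F2a) := by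
  rw [X_pow_sub_C_irreducible_iff_of_prime Nat.prime_two]
  intro b hb
  exact not_isSquare_fa_mul ⟨b, hb⟩

/-- This is the division of the quartic by `q = y² - ab`: the quotient is `x²q + s`, and the
remainder is a multiple of `s`. -/
theorem quartic_expansion {R : Type*} [CommRing R] [CharP R 2] (a x y : R) :
    (1 + (a + 1) * x) * (a + 1) * y + (1 + (a + 1) * x) * (a * ((a + 1) * x + a)) +
      (y ^ 2 - a * (a + 1)) * (x ^ 2 * (y ^ 2 - a * (a + 1)) + (1 + (a + 1) * x)) =
    x ^ 2 * y ^ 4 + (1 + (a + 1) * x) * y ^ 2 + (a + 1) * (1 + (a + 1) * x) * y +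
      a * ((a + 1) ^ 3 * x ^ 2 + 1) := by
  grind

theorem irreducible_integralQuartic : Irreducible integralQuartic := by
  have hb := fa_add_one_ne_zero
  have h2 := F2a.two_eq_zero
  set β : F2a := (fa + 1)⁻¹ with hβ
  have hbβ : (fa + 1) * β = 1 := mul_inv_cancel₀ hb
  -- The residue field at the prime `(s) = (x - β)` is `𝔽₂(a)` itself, through evaluation at the
  -- root `β = 1/(a + 1)` of `s`.
  let _ : Algebra (Polynomial F2a) F2a := (Polynomial.evalRingHom β).toAlgebra
  have hmap : algebraMap (Polynomial F2a) F2a = Polynomial.evalRingHom β := rfl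
  set q : Polynomial (Polynomial F2a) :=
    Polynomial.X ^ 2 - Polynomial.C (Polynomial.C (fa * (fa + 1))) with hq
  have hqm : q.Monic := Polynomial.monic_X_pow_sub_C _ (by norm_num)
  have hqmap : q.map (Polynomial.evalRingHom β) =
      Polynomial.X ^ 2 - Polynomial.C (fa * (fa + 1)) := by
    simp [hq, -map_mul]
  set s : Polynomial F2a := 1 + Polynomial.C (fa + 1) * Polynomial.X with hs
  have hmod : integralQuartic %ₘ q = Polynomial.C (s * Polynomial.C (fa + 1)) * Polynomial.X +
      Polynomial.C (s * (Polynomial.C fa *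
        (Polynomial.C (fa + 1) * Polynomial.X + Polynomial.C fa))) := by
    refine (Polynomial.div_modByMonic_unique
      (Polynomial.C (Polynomial.X ^ 2) * q + Polynomial.C s) _ hqm ⟨?_, ?_⟩).2
    · simp only [hq, hs, integralQuartic, map_add, map_mul, map_pow, map_one]
      exact quartic_expansion _ _ _
    · rw [hq, Polynomial.degree_X_pow_sub_C (by norm_num)]
      exact Polynomial.degree_linear_lt
  refine Polynomial.generalizedEisenstein (K := F2a) (q := q) (p := 2) ?_ hqm
    isPrimitive_integralQuartic ?_ ?_ ?_ ?_
  · rw [hmap, hqmap]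
    exact irreducible_X_sq_sub
  · rw [natDegree_integralQuartic]; norm_num
  · rw [leadingCoeff_integralQuartic, hmap]
    simpa [hβ] using hb
  · rw [leadingCoeff_integralQuartic, hmap, hqmap]
    have hsβ : s.eval β = 0 := by
      simp only [hs, Polynomial.eval_add, Polynomial.eval_one, Polynomial.eval_mul,
        Polynomial.eval_C, Polynomial.eval_X, hbβ]
      linear_combination h2
    have hβb : β ^ 2 * (fa + 1) ^ 3 + 1 = fa := by
      linear_combination ((fa + 1) * ((fa + 1) * β + 1)) * hbβ + h2
    have hsq : β ^ 2 * (fa * (fa + 1)) ^ 2 = fa ^ 2 := by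
      linear_combination fa ^ 2 * ((fa + 1) * β + 1) * hbβ
    -- At `x = β` both middle terms carry the factor `s` and vanish; what is left is `β²y⁴ + a² =
    -- β²(y² - ab)²`.
    have hP : integralQuartic.map (Polynomial.evalRingHom β) =
        Polynomial.C (β ^ 2) * Polynomial.X ^ 4 + Polynomial.C (fa ^ 2) := by
      simp only [integralQuartic, Polynomial.map_add, Polynomial.map_mul, Polynomial.map_C,
        Polynomial.map_pow, Polynomial.map_X, Polynomial.coe_evalRingHom, ← hs,
        Polynomial.eval_mul, hsβ, Polynomial.eval_add, Polynomial.eval_pow, Polynomial.eval_X,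
        Polynomial.eval_C, Polynomial.eval_one]
      rw [show fa * ((fa + 1) ^ 3 * β ^ 2 + 1) = fa ^ 2 by linear_combination fa * hβb]
      simp
    have h2C : (Polynomial.C 2 : Polynomial F2a) = 0 := by rw [h2, map_zero]
    have h2C' : (2 : Polynomial F2a) = 0 := h2C
    rw [hP, ← hsq]
    simp only [Polynomial.coe_evalRingHom, Polynomial.eval_X, map_mul,
      map_pow]
    linear_combination Polynomial.C β ^ 2 * Polynomial.X ^ 2 *
      (Polynomial.C fa * Polynomial.C (fa + 1)) * h2C'
  · rw [hmod]
    intro h0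
    -- The coefficient of `y` in the remainder is `sb`, which vanishes only to first order at `β`.
    have h1 := congrArg (fun p => p.coeff 1) h0
    simp only [Polynomial.coeff_map, Polynomial.coeff_add, Polynomial.coeff_C_mul,
      Polynomial.coeff_X_one, Polynomial.coeff_C_succ, mul_one, add_zero,
      Polynomial.coeff_zero] at h1
    rw [Ideal.Quotient.eq_zero_iff_mem, hmap, Polynomial.ker_evalRingHom, Ideal.span_singleton_pow,
      Ideal.mem_span_singleton] at h1
    have hsX : s = (Polynomial.X - Polynomial.C β) * Polynomial.C (fa + 1) := by
      have e : (1 : Polynomial F2a) = -(Polynomial.C β * Polynomial.C (fa + 1)) := by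
        rw [← map_mul, mul_comm β, hbβ, ← map_neg, ← map_one Polynomial.C]
        congr 1
        linear_combination h2
      rw [hs, sub_mul]
      linear_combination e
    rw [hsX, sq, mul_assoc, mul_dvd_mul_iff_left (Polynomial.X_sub_C_ne_zero β),
      Polynomial.dvd_iff_isRoot] at h1
    simp [-map_add, hb] at h1

theorem quarticCoeff_ne : (ca ^ 6 + ca ^ 5 : RatFunc F2a) ≠ 0 := by
  have h : (ca ^ 6 + ca ^ 5 : RatFunc F2a) = RatFunc.C (fa ^ 5 * (fa + 1)) := by
    simp only [ca, map_mul, map_pow, map_add, map_one]; ring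
  rw [h]
  exact (map_ne_zero _).2 (mul_ne_zero (pow_ne_zero _ fa_ne_zero) fa_add_one_ne_zero)

/-- By Gauss's lemma, irreducibility over `𝔽₂(a)[x]` then passes to `quartic`. -/
theorem quartic_eq_C_mul_map : quartic = Polynomial.C (1 / (ca ^ 6 + ca ^ 5)) *
    integralQuartic.map (algebraMap (Polynomial F2a) (RatFunc F2a)) := by
  have h := quarticCoeff_ne
  have ha : (ca : RatFunc F2a) ≠ 0 := by rintro h'; simp [h'] at h
  have hb : (ca + 1 : RatFunc F2a) ≠ 0 := by
    rintro h'; apply h; linear_combination ca ^ 5 * h'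
  have h2 : (2 : RatFunc F2a) = 0 := by
    have : CharP (RatFunc F2a) 2 := 
      charP_of_injective_algebraMap (algebraMap (ZMod 2) (RatFunc F2a)).injective 2
    exact CharTwo.two_eq_zero
  have e0 : quarticP0 = 1 / (ca ^ 6 + ca ^ 5) * (ca * ((ca + 1) ^ 3 * RatFunc.X ^ 2 + 1)) := by
    rw [quarticP0, show ca ^ 6 + ca ^ 5 = ca ^ 5 * (ca + 1) by ring,
      show ca ^ 5 + ca ^ 4 = ca ^ 4 * (ca + 1) by ring]
    field_simp
    linear_combination (-(ca * (ca + 1) * RatFunc.X ^ 2)) * h2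
  have e1 : quarticP1 = 1 / (ca ^ 6 + ca ^ 5) * ((ca + 1) * (1 + (ca + 1) * RatFunc.X)) := by
    rw [quarticP1, show ca ^ 6 + ca ^ 5 = ca ^ 5 * (ca + 1) by ring]
    field_simp
    ring
  have e2 : quarticP2 = 1 / (ca ^ 6 + ca ^ 5) * (1 + (ca + 1) * RatFunc.X) := by
    rw [quarticP2, show ca ^ 6 + ca ^ 5 = ca ^ 5 * (ca + 1) by ring]
    field_simp
    ring
  rw [quartic, e0, e1, e2, quarticP4]
  simp [integralQuartic, ca]
  ring

theorem irreducible_quartic : Irreducible quartic := by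
  have h := (isPrimitive_integralQuartic.irreducible_iff_irreducible_map_fraction_map
    (K := RatFunc F2a)).1 irreducible_integralQuartic
  rw [quartic_eq_C_mul_map]
  refine (irreducible_isUnit_mul ?_).2 h
  exact Polynomial.isUnit_C.2 (one_div_ne_zero quarticCoeff_ne).isUnit

theorem quarticP4_ne_zero : quarticP4 ≠ 0 :=
  mul_ne_zero (one_div_ne_zero quarticCoeff_ne) (pow_ne_zero _ RatFunc.X_ne_zero)

theorem leadingCoeff_quartic : quartic.leadingCoeff = quarticP4 := by
  have h := quarticP4_ne_zero
  have hd : quartic.natDegree = 4 := by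
    unfold quartic
    compute_degree!
  rw [Polynomial.leadingCoeff, hd]
  simp [quartic, Polynomial.coeff_X_pow]

/-! ### The power series root and its identification with the continued fraction -/

theorem exists_quartic_root : ∃ g : F2a⟦X⟧, PowerSeries.constantCoeff g = fa ∧
    PowerSeries.X ^ 2 * g ^ 4 + (1 + PowerSeries.C (fa + 1) * PowerSeries.X) * g ^ 2 +
      PowerSeries.C (fa + 1) * (1 + PowerSeries.C (fa + 1) * PowerSeries.X) * g +
      PowerSeries.C fa * (PowerSeries.C ((fa + 1) ^ 3) * PowerSeries.X ^ 2 + 1) = 0 := by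
  have ha := fa_ne_zero
  have h2 := F2a.two_eq_zero
  set s : F2a⟦X⟧ := 1 + PowerSeries.C (fa + 1) * PowerSeries.X with hs
  set c : F2a⟦X⟧ := PowerSeries.C fa *
    (PowerSeries.C ((fa + 1) ^ 3) * PowerSeries.X ^ 2 + 1) with hc
  have hc0 : PowerSeries.constantCoeff c = fa := by simp [hc]
  have hs0 : PowerSeries.constantCoeff s = 1 := by simp [hs]
  have hcc : c * c⁻¹ = 1 := PowerSeries.mul_inv_cancel _ (by rw [hc0]; exact ha)
  -- The leading coefficient `x²` is not a unit, but the constant term `c` is. So Hensel's lemma is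
  -- applied to the monic reversed polynomial in `z = 1/y`, which at `x = 0` is `z²(z + 1)(z + 1/a)`
  -- with simple root `1/a`.
  set P : Polynomial F2a⟦X⟧ := Polynomial.X ^ 4 +
    Polynomial.C (c⁻¹ * (PowerSeries.C (fa + 1) * s)) * Polynomial.X ^ 3 +
    Polynomial.C (c⁻¹ * s) * Polynomial.X ^ 2 + Polynomial.C (c⁻¹ * PowerSeries.X ^ 2) with hP
  have hPm : P.Monic := by rw [hP]; monicity!
  obtain ⟨z, hz, hz0⟩ := HenselianRing.is_henselian (I := Ideal.span {(PowerSeries.X : F2a⟦X⟧)})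
    P hPm (PowerSeries.C fa⁻¹) (by
      rw [Ideal.mem_span_singleton, PowerSeries.X_dvd_iff]
      simp [hP, hc0, hs0]
      field_simp
      linear_combination (fa + 1) * h2) (by
      apply IsUnit.map
      rw [PowerSeries.isUnit_iff_constantCoeff]
      apply IsUnit.mk0
      have : PowerSeries.constantCoeff (Polynomial.eval (PowerSeries.C fa⁻¹)
        (Polynomial.derivative P)) = (fa + 1) / fa ^ 3 := by
        simp [hP, hc0, hs0, Polynomial.derivative_pow, map_ofNat]
        field_simp
        linear_combination (3 + 2 * fa) * h2
      rw [this]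
      exact div_ne_zero fa_add_one_ne_zero (pow_ne_zero _ ha))
  rw [Ideal.mem_span_singleton, PowerSeries.X_dvd_iff, map_sub, PowerSeries.constantCoeff_C,
    sub_eq_zero] at hz0
  have hzz : z * z⁻¹ = 1 := PowerSeries.mul_inv_cancel _ (by rw [hz0]; exact inv_ne_zero ha)
  refine ⟨z⁻¹, by simp [hz0], ?_⟩
  simp only [hP, Polynomial.IsRoot.def, Polynomial.eval_add, Polynomial.eval_mul,
    Polynomial.eval_pow, Polynomial.eval_X, Polynomial.eval_C] at hz
  have hz' : c * z ^ 4 + PowerSeries.C (fa + 1) * s * z ^ 3 + s * z ^ 2 +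
      PowerSeries.X ^ 2 = 0 := by
    linear_combination c * hz -
      (PowerSeries.C (fa + 1) * s * z ^ 3 + s * z ^ 2 + PowerSeries.X ^ 2) * hcc
  generalize z⁻¹ = y at *
  have e1 : z ^ 2 * y ^ 2 = 1 := by rw [← mul_pow, hzz, one_pow]
  have e2 : z ^ 3 * y ^ 3 = 1 := by rw [← mul_pow, hzz, one_pow]
  have e3 : z ^ 4 * y ^ 4 = 1 := by rw [← mul_pow, hzz, one_pow]
  linear_combination y ^ 4 * hz' - c * e3 - PowerSeries.C (fa + 1) * s * y * e2 - s * y ^ 2 * e1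

/-- Modulo `x^u` with `u = 2^(2k-1)`, `Mᵉ` agrees with `M_{2k}` and the infinite continued fraction
with the finite one of `2^(2k)` terms; `k` is arbitrarily large. -/
theorem X_mul_stieltjes_mul (h : TruncationIdentities) :
    PowerSeries.X * stieltjes (thueMorse fa 1) * matMe 0 0 = matMe 0 1 := by
  rw [← sub_eq_zero]
  refine PowerSeries.eq_zero_of_forall_X_pow_dvd fun n => ?_
  obtain ⟨k, hk, hkn⟩ : ∃ k, 2 ≤ k ∧ n ≤ 2 ^ (2 * k - 1) :=
    ⟨n + 2, by omega, (Nat.lt_two_pow_self (n := n)).le.trans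
      (Nat.pow_le_pow_right (by norm_num) (by omega))⟩
  refine ⟨2 ^ (2 * k - 1), hkn, ?_⟩
  have hM := (h.1 k _ hk rfl).1
  set u := 2 ^ (2 * k - 1) with hu
  obtain ⟨N, hN⟩ : ∃ N, 2 ^ (2 * k) = N + 1 := Nat.exists_eq_succ_of_ne_zero (by positivity)
  have huN : u ≤ N + 1 := by
    rw [← hN, hu]; exact Nat.pow_le_pow_right (by norm_num) (by omega)
  have hcf := X_mul_stieltjesFin_mul N (thueMorse fa 1)
  rw [← hN] at hcf
  change _ * matM (2 * k) 0 0 = matM (2 * k) 0 1 at hcf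
  have h00 : (PowerSeries.X : F2a⟦X⟧) ^ u ∣ matM (2 * k) 0 0 - matMe 0 0 := by
    have : matM (2 * k) 0 0 - matMe 0 0 = (truncMatrix u matMe 0 0 - matMe 0 0) +
        PowerSeries.C (fa ^ (u / 2)) * PowerSeries.X ^ u := by
      rw [hM]; simp [diagTerm]; ring
    rw [this]
    exact dvd_add (X_pow_dvd_truncMatrix_sub u _ _ _) (dvd_mul_left _ _)
  have h01 : (PowerSeries.X : F2a⟦X⟧) ^ u ∣ matM (2 * k) 0 1 - matMe 0 1 := by
    have : matM (2 * k) 0 1 - matMe 0 1 = truncMatrix u matMe 0 1 - matMe 0 1 := by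
      rw [hM]; simp [diagTerm]
    rw [this]
    exact X_pow_dvd_truncMatrix_sub u _ _ _
  have hst := (pow_dvd_pow (PowerSeries.X : F2a⟦X⟧) huN).trans
    (X_pow_dvd_stieltjes_sub (thueMorse fa 1) N)
  have e : PowerSeries.X * stieltjes (thueMorse fa 1) * matMe 0 0 - matMe 0 1 =
      (stieltjes (thueMorse fa 1) - stieltjesFin (thueMorse fa 1) N) *
        (PowerSeries.X * matMe 0 0) -
      (matM (2 * k) 0 0 - matMe 0 0) * (PowerSeries.X * stieltjesFin (thueMorse fa 1) N) +
      (matM (2 * k) 0 1 - matMe 0 1) := by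
    linear_combination hcf
  rw [e]
  exact dvd_add (dvd_sub (hst.mul_right _) (h00.mul_right _)) h01

/-- Besides supplying constant terms, this shows that the entries are not the default `0`, so they
are the unique roots in question. -/
theorem constantCoeff_matMe_col_zero (h : TruncationIdentities) (i : Fin 2) :
    PowerSeries.constantCoeff (matMe i 0) = 1 := by
  have hM := (h.1 2 8 le_rfl (by norm_num)).1
  have hc : PowerSeries.constantCoeff (matM (2 * 2) i 0) = 1 := by
    have := constantCoeff_stieltjesProd_col_zero (thueMorse fa 1) 15
    fin_cases i
    · exact this.1
    · exact this.2
  have hd := X_pow_dvd_truncMatrix_sub 8 matMe i 0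
  have h0 := PowerSeries.X_pow_dvd_iff.1 hd 0 (by norm_num)
  rw [PowerSeries.coeff_zero_eq_constantCoeff_apply, map_sub, sub_eq_zero] at h0
  rw [← h0, ← hc, hM]
  simp [diagTerm]

theorem stieltjes_quartic (h : TruncationIdentities) :
    PowerSeries.X ^ 2 * stieltjes (thueMorse fa 1) ^ 4 +
      (1 + PowerSeries.C (fa + 1) * PowerSeries.X) * stieltjes (thueMorse fa 1) ^ 2 +
      PowerSeries.C (fa + 1) * (1 + PowerSeries.C (fa + 1) * PowerSeries.X) *
        stieltjes (thueMorse fa 1) +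
      PowerSeries.C fa * (PowerSeries.C ((fa + 1) ^ 3) * PowerSeries.X ^ 2 + 1) = 0 := by
  obtain ⟨g, hg0, hg⟩ := exists_quartic_root
  suffices hfg : stieltjes (thueMorse fa 1) = g by rw [hfg]; exact hg
  have hne (i : Fin 2) : matMe i 0 ≠ 0 := by
    intro h0
    have := constantCoeff_matMe_col_zero h i
    simp [h0] at this
  have hf0 : stieltjes (thueMorse fa 1) ≠ 0 := by
    intro h0
    have := constantCoeff_stieltjes (thueMorse fa 1)
    rw [h0, map_zero] at this
    exact fa_ne_zero this.symm
  have hcf := X_mul_stieltjes_mul h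
  -- The constant term of this entry is `0`, so its nonvanishing has to come from the continued
  -- fraction identity.
  have hne01 : matMe 0 1 ≠ 0 := by
    rw [← hcf]
    exact mul_ne_zero (mul_ne_zero PowerSeries.X_ne_zero hf0) (hne 0)
  obtain ⟨hT, hT0, hT1⟩ := uniqueSolution_spec (hne 1)
  change phiMe10 (PowerSeries.C fa) PowerSeries.X (matMe 1 0) = 0 at hT
  change PowerSeries.coeff 0 (matMe 1 0) = 1 at hT0
  change PowerSeries.coeff 1 (matMe 1 0) = 0 at hT1
  set T := matMe 1 0 with hTdef
  set t : F2a⟦X⟧ := (PowerSeries.C fa + 1) * PowerSeries.X with ht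
  have hw : (PowerSeries.X * g) ^ 4 + (1 + t) * (PowerSeries.X * g) ^ 2 +
      t * (1 + t) * (PowerSeries.X * g) + PowerSeries.C fa * PowerSeries.X ^ 2 *
        ((PowerSeries.C fa + 1) ^ 3 * PowerSeries.X ^ 2 + 1) = 0 := by
    simp only [map_add, map_pow, map_one] at hg
    rw [ht]
    linear_combination PowerSeries.X ^ 2 * hg
  have hT3 : (1 + t) ^ 2 * T ^ 3 = 1 :=
    sq_mul_cube_of_phiMe10_eq_zero _ _ _ _ _ ht rfl hT
  -- Since `T = 1 + 0·x + ⋯` and `w = ax + ⋯`, the two candidates begin with `1 + ax` and `0 + ax`,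
  -- the prescribed initial terms.
  have e00 : matMe 0 0 = T * (1 + PowerSeries.X * g) := by
    refine uniqueSolution_eq (hne 0) (phiMe00_eq_zero _ _ T _ t _ ht rfl hw hT3) ?_ ?_
    · simp_all
    · simp_all [PowerSeries.coeff_one_mul]
  have e01 : matMe 0 1 = T * (PowerSeries.X * g * (1 + PowerSeries.X * g)) := by
    refine uniqueSolution_eq hne01 (phiMe01_eq_zero _ _ T _ t _ ht rfl hw hT3) ?_ ?_
    · simp_all
    · simp_all [PowerSeries.coeff_one_mul]
  rw [e01, show T * (PowerSeries.X * g * (1 + PowerSeries.X * g)) =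
    PowerSeries.X * g * matMe 0 0 by rw [e00]; ring] at hcf
  exact mul_left_cancel₀ PowerSeries.X_ne_zero (mul_right_cancel₀ (hne 0) hcf)

theorem aeval_quartic_stieltjesTM (h : TruncationIdentities) :
    Polynomial.aeval stieltjesTM quartic = 0 := by
  have hs := congrArg (HahnSeries.ofPowerSeries ℤ F2a) (stieltjes_quartic h)
  have hX : algebraMap (RatFunc F2a) F2a⸨X⸩ RatFunc.X =
      HahnSeries.ofPowerSeries ℤ F2a PowerSeries.X := by
    rw [RatFunc.coe_X, HahnSeries.ofPowerSeries_X]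
  have hC (r : F2a) : algebraMap (RatFunc F2a) F2a⸨X⸩ (RatFunc.C r) =
      HahnSeries.ofPowerSeries ℤ F2a (PowerSeries.C r) := by
    have e := RatFunc.coe_coe (Polynomial.C r)
    rw [Polynomial.coe_C] at e
    rw [← RatFunc.algebraMap_C]
    exact e.symm
  rw [quartic_eq_C_mul_map, map_mul, Polynomial.aeval_map_algebraMap]
  refine mul_eq_zero_of_right _ ?_
  rw [← Polynomial.aeval_map_algebraMap (RatFunc F2a)]
  simp only [integralQuartic, Polynomial.map_add, Polynomial.map_mul, Polynomial.map_C,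
    Polynomial.map_pow, Polynomial.map_X, Polynomial.map_one, map_add, map_mul, map_pow, map_one,
    RatFunc.algebraMap_X, RatFunc.algebraMap_C, Polynomial.aeval_C, Polynomial.aeval_X, hX, hC,
    map_zero] at hs ⊢
  exact hs

theorem mainTheorem4 (h : TruncationIdentities) :
    IsAlgebraic (RatFunc F2a) stieltjesTM ∧
      quarticP4 ≠ 0 ∧
      quartic = Polynomial.C quarticP4 * minpoly (RatFunc F2a) stieltjesTM := by
  have h₀ := aeval_quartic_stieltjesTM h
  refine ⟨⟨quartic, irreducible_quartic.ne_zero, h₀⟩, quarticP4_ne_zero, ?_⟩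
  rw [← minpoly.eq_of_irreducible irreducible_quartic h₀, leadingCoeff_quartic,
    mul_comm quartic, ← mul_assoc, ← Polynomial.C_mul, mul_inv_cancel₀ quarticP4_ne_zero,
    Polynomial.C_1, one_mul]
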